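/- **Model.** A network is a finite connected simple graph $G=(V,E)$ with $n=|V|$ vertices and diameter $D$; the vertices have no identifiers. A *labeling* gives every vertex a string over a fixed finite alphabet. A *verifier* is one fixed finite program (a finite control with a work tape whose initial content is the label of the vertex; it depends neither on $G$, nor on $n$, nor on the number of rounds) that is run by all vertices in synchronous rounds. In each round a vertex sends one message, a letter of a fixed finite alphabet, to each neighbor (the messages to different neighbors may differ), scans the messages it receives one after the other, in an arbitrary order of its neighbors, and updates its memory, until it halts and outputs $\mathrm{true}$ or $\mathrm{false}$. The *space* of a vertex is the number of bits of its memory (tape cells used, including the label, head position, and control state). A labeled network is *accepted* if all vertices output $\mathrm{true}$ and *rejected* if some vertex outputs $\mathrm{false}$. A *$t$-round proof-labeling scheme* ($t$-PLS) for a predicate $\mathcal P$ consists of a verifier that halts at all vertices within $t$ rounds on every network with every labeling, and of a prover that assigns a labeling to every network, such that every network satisfying $\mathcal P$ is accepted with the prover's labeling (completeness) and every network violating $\mathcal P$ is rejected with every labeling (soundness). Let $\log^* n$ be the least $k$ such that the $k$-fold iterated binary logarithm of $n$ is at most $1$. **Theorem.** There are a proof-labeling scheme and a constant $C$ (both independent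 of the network) such that: 1. The scheme is a $(Cn)$-PLS for the predicate "$G$ is acyclic" on the family of all connected graphs $G$, where $n$ is the number of vertices. In particular the verifier is given no information about $n$ or the number of rounds. 2. In each round, each message sent along an edge consists of at most $C$ bits. 3. On every network and for every labeling, each vertex uses at all times space at most $C(s+1)$ bits, where $s$ is the size in bits of its label. 4. On every acyclic connected $G$, the prover's labels have size at most $C(\log^* n+1)$ bits, with these labels each vertex uses space at most $C(\log^* n+1)$ bits, and all vertices halt and output $\mathrm{true}$ within $C(\lfloor\log_2 D\rfloor+1)$ rounds (where $\lfloor\log_2 0\rfloor$ is read as $0$). -/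

import Mathlib

/-- Iterated logarithm: the least `k` such that the `k`-fold iterated binary logarithm of `n`
is at most `1`. -/
noncomputable def logStar (n : ℕ) : ℕ :=
  sInf {k : ℕ | (Real.logb 2)^[k] (n : ℝ) ≤ 1}

/-! ### The processor at a vertex

Every vertex runs the same finite program on a work tape. The initial content of the tape is the
label of the vertex, and the program gets no other input (no identifier, no `n`, no bound on the
number of rounds). Every message is one letter of a fixed finite alphabet. -/

/-- Movement of the tape head. -/
inductive HeadMove where
  | left
  | stay
  | right

/-- One elementary step: new control state, optional symbol to be written, head movement. -/
structure LocalStep (Q Γ : Type) where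
  next : Q
  write : Option Γ
  move : HeadMove

/-- The memory of a vertex: control state, the tape cells used so far, and the head position. -/
structure Memory (Q Γ : Type) where
  ctrl : Q
  tape : List Γ
  pos : ℕ

namespace Memory

variable {Q Γ : Type}

/-- The scanned symbol; `none` means that the head is on the fresh cell behind the tape content. -/
def scanned (m : Memory Q Γ) : Option Γ := m.tape[m.pos]?

/-- Execute one elementary step. Writing on the fresh cell extends the tape by one cell; cells are
never released, so the length of the tape is the number of cells used up to now. -/
def act (m : Memory Q Γ) (a : LocalStep Q Γ) : Memory Q Γ :=
  let tape' : List Γ :=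
    match a.write with
    | none => m.tape
    | some g => if m.pos < m.tape.length then m.tape.set m.pos g else m.tape ++ [g]
  { ctrl := a.next
    tape := tape'
    pos :=
      match a.move with
      | HeadMove.left => m.pos - 1
      | HeadMove.stay => m.pos
      | HeadMove.right => min (m.pos + 1) tape'.length }

end Memory

/-- A distributed verifier: one finite program, executed by all vertices. In each round a vertex
executes `send` once per neighbour (so different neighbours may get different messages), then
scans its incoming messages in a streaming fashion, executing `recv` once per message, and
finally executes `think`. It has halted with output `b` when `output` of its control state is
`some b`. -/
structure Verifier where
  /-- control states -/
  State : Type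
  /-- alphabet of labels and tapes -/
  Sym : Type
  /-- alphabet of messages -/
  Msg : Type
  fintypeState : Fintype State
  fintypeSym : Fintype Sym
  fintypeMsg : Fintype Msg
  start : State
  send : State → Option Sym → LocalStep State Sym × Msg
  /-- the message `none` is what is received from a neighbour that has halted -/
  recv : State → Option Sym → Option Msg → LocalStep State Sym
  think : State → Option Sym → LocalStep State Sym
  output : State → Option Bool

attribute [instance] Verifier.fintypeState Verifier.fintypeSym Verifier.fintypeMsg

/-- For every vertex, the order in which its neighbours are served and scanned. -/
structure PortOrder {V : Type} (G : SimpleGraph V) where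
  nbrs : V → List V
  nodup : ∀ v, (nbrs v).Nodup
  mem_iff : ∀ v u, u ∈ nbrs v ↔ G.Adj v u

namespace Verifier

variable (A : Verifier)

/-- Memory of a vertex running `A`. -/
abbrev Mem : Type := Memory A.State A.Sym

/-- A labeling: every vertex gets a string over the alphabet of `A`. -/
abbrev Labeling (V : Type) : Type := V → List A.Sym

/-- Size of a label in bits. -/
def labelBits (l : List A.Sym) : ℕ := l.length * Nat.size (Fintype.card A.Sym)

/-- Size of a message in bits. -/
def messageBits : ℕ := Nat.size (Fintype.card A.Msg)

/-- Space, in bits, used by a vertex up to now: the tape (which initially holds the label), the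
head position, and the control state. -/
def space (m : A.Mem) : ℕ :=
  m.tape.length * Nat.size (Fintype.card A.Sym) + Nat.size m.tape.length +
    Nat.size (Fintype.card A.State)

/-- The output of a vertex, `none` as long as it has not halted. -/
def result (m : A.Mem) : Option Bool := A.output m.ctrl

/-- Send a message to each vertex of a list, one after the other. -/
def sendAll {V : Type} [DecidableEq V] : A.Mem → List V → A.Mem × (V → Option A.Msg)
  | m, [] => (m, fun _ => none)
  | m, u :: us =>
    let o := A.send m.ctrl m.scanned
    let rest := sendAll (m.act o.1) us
    (rest.1, fun w => if w = u then some o.2 else rest.2 w)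

/-- Read one message. -/
def recvOne (m : A.Mem) (x : Option A.Msg) : A.Mem := m.act (A.recv m.ctrl m.scanned x)

section Execution

variable {V : Type} [DecidableEq V] {G : SimpleGraph V} (π : PortOrder G)

/-- The message on the edge from `u` to `v` in the next round, `none` if `u` has halted. -/
def delivered (c : V → A.Mem) (u v : V) : Option A.Msg :=
  if (A.result (c u)).isSome then none else (A.sendAll (c u) (π.nbrs u)).2 v

/-- One synchronous round. -/
def round (c : V → A.Mem) : V → A.Mem := fun v =>
  if (A.result (c v)).isSome then c v
  else
    let m₁ := (A.sendAll (c v) (π.nbrs v)).1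
    let m₂ := (π.nbrs v).foldl (fun m u => A.recvOne m (A.delivered π c u v)) m₁
    m₂.act (A.think m₂.ctrl m₂.scanned)

/-- The memories of all vertices after `r` rounds on the labeling `l`. -/
def run (l : A.Labeling V) : ℕ → V → A.Mem
  | 0 => fun v => { ctrl := A.start, tape := l v, pos := 0 }
  | r + 1 => A.round π (run l r)

/-- Every vertex halts within `r` rounds. -/
def HaltsWithin (l : A.Labeling V) (r : ℕ) : Prop :=
  ∀ v, (A.result (A.run π l r v)).isSome

/-- Every vertex halts within `r` rounds and outputs `true`. -/
def AcceptsWithin (l : A.Labeling V) (r : ℕ) : Prop :=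
  ∀ v, A.result (A.run π l r v) = some true

/-- The labeled graph is accepted: all vertices output `true`. -/
def Accepts (l : A.Labeling V) : Prop := ∃ r, A.AcceptsWithin π l r

/-- The labeled graph is rejected: some vertex outputs `false`. -/
def Rejects (l : A.Labeling V) : Prop := ∃ r v, A.result (A.run π l r v) = some false

end Execution

end Verifier

/-- A proof-labeling scheme: a verifier together with a prover, an oracle which assigns labels to
the vertices of every graph. -/
structure ProofLabelingScheme where
  verifier : Verifier
  prover : (V : Type) → SimpleGraph V → verifier.Labeling V

/-- `S` is a `t`-round proof-labeling scheme for the predicate `P` on the family `F`, where the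
number `t n` of rounds may depend on the number `n` of vertices: on every graph of the family and
for every labeling all vertices halt within `t n` rounds, and `S` is complete and sound. -/
structure ProofLabelingScheme.IsPLS (S : ProofLabelingScheme)
    (F P : (V : Type) → SimpleGraph V → Prop) (t : ℕ → ℕ) : Prop where
  halts : ∀ (V : Type) [Fintype V] [DecidableEq V] (G : SimpleGraph V), F V G →
    ∀ (π : PortOrder G) (l : S.verifier.Labeling V),
      S.verifier.HaltsWithin π l (t (Fintype.card V))
  complete : ∀ (V : Type) [Fintype V] [DecidableEq V] (G : SimpleGraph V), F V G → P V G →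
    ∀ π : PortOrder G, S.verifier.Accepts π (S.prover V G)
  sound : ∀ (V : Type) [Fintype V] [DecidableEq V] (G : SimpleGraph V), F V G → ¬ P V G →
    ∀ (π : PortOrder G) (l : S.verifier.Labeling V), S.verifier.Rejects π l

/-!
# A proof-labeling scheme for acyclicity

Every vertex is labelled with its depth modulo three, so it knows its parent, and information flows
from parents to children only; the defect to be excluded is then a cycle in the parent function.
The levels of the tree are cut into blocks of logarithmic length, and the vertices of a block carry
the digits of the number of the block, with alternating orientation: thus a vertex at offset `j` of
its block holds the digit of the same significance as its ancestor at distance `2 * j + 1`. The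
label of the `t`-th ancestor arrives in round `t`, and a signal which moves at half speed from the
start of the block tells the vertex when to compare. A cycle without a block start is found by an
election: in phase `k` the leaders have distance `2 ^ k` and alternating colours, the leaders of one
colour drop out, and the others take their new colours from the labels of those dropping out. The
labels have constant size, and the tape is never modified.
-/

/-! ### Labels, working memory and the local program -/

namespace AcyclicityScheme

/-! Colours modulo three orient the edges. Since each vertex may have only one parent, a cycle of
the graph produces an infinite ancestor chain (`exists_infinite_chain`), which by finiteness is
eventually periodic. Defects are passed down to children, so a vertex that still runs certifies that
its ancestors behaved without defect and that its memory is the explicit function `ideal` of the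
labels above it (`sane_of_run`). Soundness thus becomes a statement about a periodic sequence of
labels.

If all vertices accept, block starts occur on the chain. The comparison at mirror positions makes
all blocks equally long and makes each block number the increment of the previous one. No carry
leaves the top digit, and at the highest position that ever receives a carry the digit can only
change from 0 to 1, so the numbers cannot recur (`counter_not_periodic`, `labels_not_periodic`).

Termination is a separate matter, because a vertex finishes only at a second block start or above
the root. A directed cycle without block starts would run forever; there the election is forced to
double the gaps between leaders without ever losing all leaders, which is impossible once the gap
exceeds the length of the cycle (`election_fails`, `halts_of_six_mul_card`).

For completeness the depth in the tree is used, with blocks of length `log₂ D + 2`: the block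
numbers fit, and every vertex finishes within two block lengths. The election reads off binary
expansions: the leaders of phase `k` are the depths divisible by `2 ^ k`, coloured by bit `k`. A
vertex drops out at most once, so one bit `next` serves all phases (`electOk_path`). -/

/-- Labels of the scheme: depth modulo three, marks for the first and the last vertex of a block, one
bit of the binary counter of the block together with the carry into this bit, the orientation of
the counter, and two bits for the leader election that detects cycles without block starts. -/
structure Lab where
  color : ZMod 3
  start : Bool
  last : Bool
  bit : Bool
  carry : Bool
  flip : Bool
  parity : Bool
  next : Bool

/-- States of the slow signal, which needs two rounds per edge. -/
inductive Slow where
  | wait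
  | now
  | send
  | done

/-- Working memory of a running vertex. -/
structure Rec where
  first : Bool
  item : Option Lab
  seen : Bool
  slow : Slow
  lead : Option Bool
  tok : Option (Bool × Bool)
  fin : Bool

/-- The state `err` lasts one round before rejection. In this round an empty payload is sent, so
that unfinished children fail too instead of taking themselves for roots. -/
inductive Core where
  | run (r : Rec)
  | err
  | halt (b : Bool)

instance : Finite Lab :=
  Finite.of_injective
    (fun a : Lab => (a.color, a.start, a.last, a.bit, a.carry, a.flip, a.parity, a.next)) (by
      rintro ⟨⟩ ⟨⟩ h; simpa using h)

instance : Finite Slow :=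
  Finite.of_injective
    (fun s : Slow => match s with
      | .wait => (0 : Fin 4) | .now => 1 | .send => 2 | .done => 3) (by
      intro a b h; cases a <;> cases b <;> simp_all)

instance : Finite Rec :=
  Finite.of_injective
    (fun r : Rec => (r.first, r.item, r.seen, r.slow, r.lead, r.tok, r.fin)) (by
      rintro ⟨⟩ ⟨⟩ h; simpa using h)

instance : Finite Core :=
  Finite.of_injective
    (fun s : Core => match s with
      | .run r => (Sum.inl r : Rec ⊕ Option Bool) | .err => Sum.inr none
      | .halt b => Sum.inr (some b)) (by
      intro a b h; cases a <;> cases b <;> simp_all)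

def labOf (a : Option Lab) : Lab :=
  a.getD ⟨0, false, false, false, false, false, false, false⟩

def isStart (i : Option Lab) : Bool := i.any (·.start)

def initRec (a : Lab) : Rec where
  first := true
  item := some a
  seen := a.start
  slow := if a.start then .now else .wait
  lead := some a.parity
  tok := some (a.parity, a.next)
  fin := false

def pulse (pr : Option Rec) : Bool :=
  match pr with
  | some ⟨_, _, _, .send, _, _, _⟩ => true
  | _ => false

def slowStep (s : Slow) (p : Bool) : Slow :=
  match s with
  | .wait => if p then .now else .wait
  | .now => .send
  | .send => .done
  | .done => .done

/-- One step of the leader election: a leader with colour `true` that meets a token drops out, a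
leader with colour `false` takes its new colour from the token; other vertices relay tokens. -/
def electStep (c : Bool) (lead : Option Bool) (tok : Option (Bool × Bool)) :
    Option Bool × Option (Bool × Bool) :=
  match lead, tok with
  | none, m => (none, m)
  | some x, none => (some x, none)
  | some false, some (_, d) => (some d, some (d, c))
  | some true, some _ => (none, none)

/-- The colours of consecutive leaders have to alternate. -/
def ElectOk (lead : Option Bool) (tok : Option (Bool × Bool)) : Prop :=
  ∀ x y c, lead = some x → tok = some (y, c) → x ≠ y

/-- One step of a vertex with label `a` whose parent has memory `pr`, all checks ignored. -/
def clean (a : Lab) (r : Rec) (pr : Option Rec) : Rec where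
  first := false
  item := pr.bind Rec.item
  seen := r.seen || isStart (pr.bind Rec.item)
  slow := slowStep r.slow (pulse pr)
  lead := (electStep a.next r.lead (pr.bind Rec.tok)).1
  tok := (electStep a.next r.lead (pr.bind Rec.tok)).2
  fin := (pr.bind Rec.item).isNone || (isStart (pr.bind Rec.item) && r.seen)

/-- Consistency of the label of a vertex with the label of its parent. -/
structure LocalOk (a : Lab) (q : Option Lab) : Prop where
  root : q = none → a.start = true
  start_eq : ∀ p, q = some p → a.start = p.last
  flip_eq : ∀ p, q = some p → a.start = false → a.flip = p.flip
  carry_down : ∀ p, q = some p → a.start = false → a.flip = false →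
    p.bit = true → p.carry = true → a.carry = true
  carry_up : ∀ p, q = some p → a.start = false → a.flip = true →
    a.bit = true → a.carry = true → p.carry = true
  start_low : a.start = true → a.flip = false → a.carry = true
  start_high : a.start = true → a.flip = true → a.bit = true → a.carry = false
  last_low : a.last = true → a.flip = true → a.carry = true
  last_high : a.last = true → a.flip = false → a.bit = true → a.carry = false

/-- Consistency of the label `a` with the label `q` at the mirror position in the previous
block. -/
structure PartnerOk (a q : Lab) : Prop where
  flip_ne : a.flip ≠ q.flip
  last_eq : a.last = q.start
  bit_eq : a.bit = xor q.bit q.carry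

/-- The checks made in one step. -/
structure Check (a : Lab) (r : Rec) (pr : Option Rec) : Prop where
  loc : r.first = true → LocalOk a (pr.bind Rec.item)
  partner : r.slow = .now → ∀ q, pr.bind Rec.item = some q → PartnerOk a q
  met : isStart (pr.bind Rec.item) = true → r.seen = true → r.slow ≠ .wait
  elect : r.seen = false → isStart (pr.bind Rec.item) = false →
    ElectOk r.lead (pr.bind Rec.tok)

open scoped Classical in
noncomputable def stepRun (a : Lab) (r : Rec) (pr : Option Rec) : Core :=
  if Check a r pr then .run (clean a r pr) else .err

/-- Input gathered from the neighbours: a flag for a defect, and the message of the parent. -/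
abbrev Acc : Type := Bool × Option (Option Rec)

/-- A missing parent message may come from a root or from a halted parent. The second case is
harmless: an accepting parent leaves its child finished (`ideal_fin_succ`), and a rejecting one has
announced its error a round earlier. -/
noncomputable def next (a : Lab) (s : Core) (acc : Acc) : Core :=
  match s with
  | .halt b => .halt b
  | .err => .halt false
  | .run r =>
    if r.fin then .halt true
    else if acc.1 then .err
    else match acc.2 with
      | some none => .err
      | some (some p) => stepRun a r (some p)
      | none => stepRun a r none

def accStep (k : ZMod 3) (acc : Acc) (m : Option (ZMod 3 × Option Rec)) : Acc :=
  match m with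
  | none => acc
  | some (c, p) =>
    if c = k then (true, acc.2)
    else if c + 1 = k then
      match acc.2 with
      | none => (acc.1, some p)
      | some q => (true, some q)
    else acc

def payload : Core → Option Rec
  | .run r => some r
  | _ => none

def outcome : Core → Option Bool
  | .halt b => some b
  | _ => none

/-- The core of a control state; `none` is the start state. -/
def coreOf (a : Lab) (s : Option Core) : Core := s.getD (.run (initRec a))

noncomputable def verifier : Verifier where
  State := Option Core × Acc
  Sym := Lab
  Msg := ZMod 3 × Option Rec
  fintypeState := Fintype.ofFinite _
  fintypeSym := Fintype.ofFinite _
  fintypeMsg := Fintype.ofFinite _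
  start := (none, false, none)
  send s a := (⟨s, none, .stay⟩, ((labOf a).color, payload (coreOf (labOf a) s.1)))
  recv s a m := ⟨(s.1, accStep (labOf a).color s.2 m), none, .stay⟩
  think s a := ⟨(some (next (labOf a) (coreOf (labOf a) s.1) s.2), false, none), none, .stay⟩
  output s := s.1.bind outcome

/-! ### From the tape machine to a recursion for cores -/

section Reduction

variable {V : Type} [DecidableEq V] {G : SimpleGraph V} (π : PortOrder G)
  (l : verifier.Labeling V)

/-- The label read by a vertex: the first symbol of its string. -/
def lab (l : verifier.Labeling V) (v : V) : Lab := labOf ((l v)[0]?)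

noncomputable def core (t : ℕ) (v : V) : Core :=
  coreOf (lab l v) ((verifier.run π l t v).ctrl.1)

def msg (l : verifier.Labeling V) (K : V → Core) (u : V) : Option (ZMod 3 × Option Rec) :=
  if (outcome (K u)).isSome then none else some ((lab l u).color, payload (K u))

def gather (K : V → Core) (v : V) : Acc :=
  (π.nbrs v).foldl (fun acc u => accStep (lab l v).color acc (msg l K u)) (false, none)

theorem sendAll_eq (m : verifier.Mem) (us : List V) :
    verifier.sendAll m us = (m, fun w => if w ∈ us then
      some ((labOf m.scanned).color, payload (coreOf (labOf m.scanned) m.ctrl.1)) else none) := by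
  induction us with
  | nil => exact Prod.ext rfl (funext fun w => by simp [Verifier.sendAll]; rfl)
  | cons u us ih =>
    have h : m.act (verifier.send m.ctrl m.scanned).1 = m := rfl
    simp only [Verifier.sendAll, h, ih, List.mem_cons]
    refine Prod.ext rfl (funext fun w => ?_)
    by_cases hw : w = u
    · simp [hw]; rfl
    · simp [hw]; rfl

theorem foldl_recv {V : Type} (k : V → Option verifier.Msg) (us : List V) (m : verifier.Mem) :
    us.foldl (fun m u => verifier.recvOne m (k u)) m =
      { m with ctrl := (m.ctrl.1, us.foldl
        (fun acc u => accStep (labOf m.scanned).color acc (k u)) m.ctrl.2) } := by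
  induction us generalizing m with
  | nil => rfl
  | cons u us ih =>
    simp only [List.foldl_cons, ih]
    rfl

/-- The program never writes or moves the head, and `think` resets the accumulator. Both the
recursion for `core` and the space bound rest on this. -/
theorem run_shape (t : ℕ) (v : V) : ∃ s : Option Core,
    verifier.run π l t v = ⟨(s, false, none), l v, 0⟩ := by
  induction t with
  | zero => exact ⟨none, rfl⟩
  | succ t ih =>
    obtain ⟨s, hs⟩ := ih
    simp only [Verifier.run, Verifier.round]
    split_ifs with h
    · exact ⟨s, hs⟩
    · simp only [sendAll_eq, foldl_recv, hs]
      exact ⟨_, rfl⟩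

theorem core_zero (v : V) : core π l 0 v = .run (initRec (lab l v)) := rfl

theorem result_eq (t : ℕ) (v : V) :
    verifier.result (verifier.run π l t v) = outcome (core π l t v) := by
  obtain ⟨s, hs⟩ := run_shape π l t v
  simp only [core, hs]
  cases s <;> rfl

theorem delivered_eq (t : ℕ) {u v : V} (h : G.Adj u v) :
    verifier.delivered π (verifier.run π l t) u v = msg l (core π l t) u := by
  unfold Verifier.delivered msg
  rw [result_eq]
  split_ifs with h1
  · rfl
  · obtain ⟨s, hs⟩ := run_shape π l t u
    simp only [sendAll_eq, (π.mem_iff u v).2 h, if_true, core, hs]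
    rfl

/-- Halted vertices execute nothing, but `next` fixes halted cores, so one recursion covers all
cases. -/
theorem core_succ (t : ℕ) (v : V) :
    core π l (t + 1) v = next (lab l v) (core π l t v) (gather π l (core π l t) v) := by
  have hr := result_eq π l t v
  by_cases h : (outcome (core π l t v)).isSome
  · have : verifier.run π l (t + 1) v = verifier.run π l t v := by
      simp only [Verifier.run, Verifier.round, hr, h, if_true]
    have h2 : core π l (t + 1) v = core π l t v := by simp only [core, this]
    rw [h2]
    cases h3 : core π l t v <;> simp_all [outcome, next]
  · have hg : gather π l (core π l t) v = (π.nbrs v).foldl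
        (fun acc u => accStep (lab l v).color acc
          (verifier.delivered π (verifier.run π l t) u v)) (false, none) := by
      refine List.foldl_ext _ _ _ fun acc u hu => ?_
      rw [delivered_eq π l t ((π.mem_iff v u).1 hu).symm]
    rw [hg]
    rw [← hr] at h
    simp only [core, Verifier.run, Verifier.round]
    rw [if_neg h]
    obtain ⟨s, hs⟩ := run_shape π l t v
    simp only [sendAll_eq, foldl_recv, hs]
    rfl

end Reduction

/-! ### Reading the neighbours in arbitrary order -/

section Gather

variable {V : Type} {G : SimpleGraph V} {lb : V → Lab}

/-- The colours of the neighbours of `v` are admissible, and at most one of them is that of a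
parent. -/
structure GoodAt (G : SimpleGraph V) (lb : V → Lab) (v : V) : Prop where
  ne : ∀ u, G.Adj v u → (lb u).color ≠ (lb v).color
  unique : ∀ u w, G.Adj v u → G.Adj v w → (lb u).color + 1 = (lb v).color →
    (lb w).color + 1 = (lb v).color → u = w

open scoped Classical in
noncomputable def par (G : SimpleGraph V) (lb : V → Lab) (v : V) : Option V :=
  if h : ∃ u, G.Adj v u ∧ (lb u).color + 1 = (lb v).color then some h.choose else none

theorem par_spec {v u : V} (h : par G lb v = some u) :
    G.Adj v u ∧ (lb u).color + 1 = (lb v).color := by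
  unfold par at h
  split_ifs at h with h1
  cases h
  exact h1.choose_spec

theorem par_of_adj {v u : V} (hv : GoodAt G lb v) (h : G.Adj v u)
    (hc : (lb u).color + 1 = (lb v).color) : par G lb v = some u := by
  have h1 : ∃ u, G.Adj v u ∧ (lb u).color + 1 = (lb v).color := ⟨u, h, hc⟩
  unfold par
  rw [dif_pos h1]
  exact congrArg some (hv.unique _ _ h1.choose_spec.1 h h1.choose_spec.2 hc)

variable {k : ZMod 3} {f : V → Option (ZMod 3 × Option Rec)}

theorem foldl_skip (us : List V) (acc : Acc)
    (h : ∀ u ∈ us, ∀ c x, f u = some (c, x) → c ≠ k ∧ c + 1 ≠ k) :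
    us.foldl (fun acc u => accStep k acc (f u)) acc = acc := by
  induction us generalizing acc with
  | nil => rfl
  | cons u us ih =>
    rw [List.foldl_cons, ih _ fun w hw => h w (List.mem_cons_of_mem _ hw)]
    have := h u List.mem_cons_self
    cases hf : f u with
    | none => rfl
    | some m =>
      obtain ⟨c, x⟩ := m
      simp [accStep, this c x hf]

theorem foldl_fst_mono (us : List V) (acc : Acc) (h : acc.1 = true) :
    (us.foldl (fun acc u => accStep k acc (f u)) acc).1 = true := by
  induction us generalizing acc with
  | nil => exact h
  | cons u us ih =>
    refine ih _ ?_
    change (accStep k acc (f u)).1 = true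
    unfold accStep
    split
    · exact h
    · split_ifs
      · rfl
      · split
        · exact h
        · rfl
      · exact h

theorem accStep_snd_mono (acc : Acc) (m : Option (ZMod 3 × Option Rec))
    (h : acc.2.isSome = true) : (accStep k acc m).2.isSome = true := by
  unfold accStep
  split
  · exact h
  · split_ifs
    · exact h
    · split <;> rfl
    · exact h

theorem foldl_same_color (us : List V) (acc : Acc) {u : V} (hu : u ∈ us) {x : Option Rec}
    (hf : f u = some (k, x)) : (us.foldl (fun acc u => accStep k acc (f u)) acc).1 = true := by
  obtain ⟨s, t, rfl⟩ := List.append_of_mem hu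
  rw [List.foldl_append, List.foldl_cons]
  exact foldl_fst_mono _ _ (by simp [accStep, hf])

theorem foldl_second_parent (us : List V) (acc : Acc) (h : acc.2.isSome = true) {u : V}
    (hu : u ∈ us) {c : ZMod 3} {x : Option Rec} (hf : f u = some (c, x)) (hc : c + 1 = k) :
    (us.foldl (fun acc u => accStep k acc (f u)) acc).1 = true := by
  induction us generalizing acc with
  | nil => cases hu
  | cons w us ih =>
    rw [List.foldl_cons]
    rcases List.mem_cons.1 hu with rfl | hu
    · refine foldl_fst_mono _ _ ?_
      obtain ⟨q, hq⟩ := Option.isSome_iff_exists.1 h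
      simp only [accStep, hf, hc, if_true, hq]
      split_ifs <;> rfl
    · exact ih _ (accStep_snd_mono _ _ h) hu

theorem foldl_two_parents (us : List V) (acc : Acc) {u w : V} (hu : u ∈ us) (hw : w ∈ us)
    (huw : u ≠ w) {c d : ZMod 3} {x y : Option Rec} (hfu : f u = some (c, x))
    (hfw : f w = some (d, y)) (hc : c + 1 = k) (hd : d + 1 = k) :
    (us.foldl (fun acc u => accStep k acc (f u)) acc).1 = true := by
  have key : ∀ acc : Acc, ∀ c x, c + 1 = k → (accStep k acc (some (c, x))).2.isSome = true := by
    rintro ⟨a, b⟩ c x rfl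
    cases b <;> simp [accStep]
  induction us generalizing acc with
  | nil => cases hu
  | cons z us ih =>
    rw [List.foldl_cons]
    rcases List.mem_cons.1 hu with rfl | hu'
    · rcases List.mem_cons.1 hw with rfl | hw'
      · exact absurd rfl huw
      · exact foldl_second_parent _ _ (hfu ▸ key _ _ _ hc) hw' hfw hd
    · rcases List.mem_cons.1 hw with rfl | hw'
      · exact foldl_second_parent _ _ (hfw ▸ key _ _ _ hd) hu' hfu hc
      · exact ih _ hu' hw'

end Gather

/-! ### Actual runs compared with defect-free runs -/

section Dynamics

variable {V : Type} {G : SimpleGraph V} (π : PortOrder G) (l : verifier.Labeling V)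

theorem gather_good {v : V} (hv : GoodAt G (lab l) v) (K : V → Core) :
    gather π l K v = (false, (par G (lab l) v).bind fun u => (msg l K u).map Prod.snd) := by
  have hcol : ∀ u c x, msg l K u = some (c, x) → (lab l u).color = c := by
    intro u c x h
    unfold msg at h
    split_ifs at h
    cases h
    rfl
  unfold gather
  cases hp : par G (lab l) v with
  | none =>
    refine foldl_skip _ _ fun u hu c x hm => ?_
    have ha := (π.mem_iff v u).1 hu
    rw [← hcol u c x hm]
    refine ⟨hv.ne u ha, fun h => ?_⟩
    simp [par_of_adj hv ha h] at hp
  | some p =>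
    obtain ⟨hpa, hpc⟩ := par_spec hp
    obtain ⟨s, t, hst⟩ := List.append_of_mem ((π.mem_iff v p).2 hpa)
    have hnd := π.nodup v
    rw [hst] at hnd
    have hskip : ∀ u, u ∈ s ∨ u ∈ t → ∀ c x, msg l K u = some (c, x) →
        c ≠ (lab l v).color ∧ c + 1 ≠ (lab l v).color := by
      intro u hu c x hm
      have ha : G.Adj v u := (π.mem_iff v u).1 (by rw [hst]; simp; tauto)
      rw [← hcol u c x hm]
      refine ⟨hv.ne u ha, fun h => ?_⟩
      have := hv.unique _ _ ha hpa h hpc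
      subst this
      simp only [List.nodup_append, List.nodup_cons] at hnd
      rcases hu with hu | hu
      · exact hnd.2.2 u hu u List.mem_cons_self rfl
      · exact hnd.2.1.1 hu
    rw [hst, List.foldl_append, List.foldl_cons, foldl_skip s _ fun u hu => hskip u (Or.inl hu),
      foldl_skip t _ fun u hu => hskip u (Or.inr hu)]
    cases hm : msg l K p with
    | none => simp [accStep, hm]
    | some m =>
      obtain ⟨c, x⟩ := m
      have h1 := hcol p c x hm
      have h2 : c ≠ (lab l v).color := h1 ▸ hv.ne p hpa
      rw [h1] at hpc
      simp [accStep, hm, hpc, h2]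

/-- Halted neighbours show no colour, hence `hK`. It holds in round 0, and detection in that round
is all that is needed. -/
theorem gather_bad {v : V} (hv : ¬ GoodAt G (lab l) v) (K : V → Core)
    (hK : ∀ u, (outcome (K u)).isSome = false) : (gather π l K v).1 = true := by
  have hm : ∀ u, msg l K u = some ((lab l u).color, payload (K u)) := fun u => by
    simp [msg, hK u]
  have hmem := fun u => (π.mem_iff v u).2
  by_contra hc
  refine hv ⟨fun u hu h => hc ?_, fun u w hu hw h1 h2 => ?_⟩
  · exact foldl_same_color _ _ (hmem u hu) ((hm u).trans (by rw [h]))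
  · by_contra hne
    exact hc (foldl_two_parents _ _ (hmem u hu) (hmem w hw) hne (hm u) (hm w) h1 h2)

/-- The memories in the absence of any defect. -/
noncomputable def ideal (G : SimpleGraph V) (lb : V → Lab) : ℕ → V → Rec
  | 0 => fun v => initRec (lb v)
  | t + 1 => fun v => clean (lb v) (ideal G lb t v) ((par G lb v).map (ideal G lb t))

variable {lb : V → Lab}

/-- What the parent sees in round `t` the child sees in round `t + 1`, including all earlier starts.
Therefore a finished vertex may fall silent. -/
theorem ideal_fin_succ {t : ℕ} {u v : V} (h : par G lb v = some u)
    (hf : (ideal G lb t u).fin = true) : (ideal G lb (t + 1) v).fin = true := by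
  have hseen : ∀ t, (ideal G lb t u).seen = true → (ideal G lb (t + 1) v).seen = true := by
    intro t
    induction t with
    | zero => simp [ideal, h, clean, initRec, isStart]; tauto
    | succ t ih =>
      intro hs
      simp only [ideal, clean, Bool.or_eq_true] at hs
      rw [ideal]
      simp only [clean, Bool.or_eq_true]
      rcases hs with hs | hs
      · exact Or.inl (ih hs)
      · right
        simpa [h, ideal, clean] using hs
  cases t with
  | zero => simp [ideal, initRec] at hf
  | succ t =>
    rw [ideal]
    simp only [ideal, clean, Bool.or_eq_true, Bool.and_eq_true] at hf
    simp only [clean, Bool.or_eq_true, Bool.and_eq_true]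
    rcases hf with hf | hf
    · left; simpa [h, ideal, clean] using hf
    · exact Or.inr ⟨by simpa [h, ideal, clean] using hf.1, hseen t hf.2⟩

variable [DecidableEq V]

theorem next_good_of_run {t : ℕ} {v : V} {r : Rec} (h : core π l (t + 1) v = .run r) :
    ∃ r', core π l t v = .run r' ∧ r'.fin = false ∧ (t = 0 → GoodAt G (lab l) v) ∧
      (GoodAt G (lab l) v →
        (∀ u, par G (lab l) v = some u → core π l t u ≠ .err) ∧
        ∀ pr, (∀ u, par G (lab l) v = some u → ∃ q, core π l t u = .run q ∧ pr = some q) →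
          (par G (lab l) v = none → pr = none) →
          Check (lab l v) r' pr ∧ r = clean (lab l v) r' pr) := by
  rw [core_succ] at h
  cases hc : core π l t v with
  | halt b => simp [hc, next] at h
  | err => simp [hc, next] at h
  | run r' =>
    rw [hc] at h
    simp only [next] at h
    split_ifs at h with h1 h2
    refine ⟨r', rfl, by simpa using h1, ?_, ?_⟩
    · rintro rfl
      by_contra hb
      exact h2 (gather_bad π l hb _ fun u => by rw [core_zero]; rfl)
    · intro hg
      rw [gather_good π l hg] at h
      refine ⟨fun u hu he => ?_, fun pr hpr hn => ?_⟩
      · simp [hu, msg, he, outcome, payload] at h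
      · cases hp : par G (lab l) v with
        | none =>
          simp only [hp, Option.bind_none, stepRun] at h
          rw [hn hp]
          split_ifs at h with h3
          · cases h; exact ⟨h3, rfl⟩
        | some u =>
          obtain ⟨q, hq, rfl⟩ := hpr u hp
          simp only [hp, Option.bind_some, msg, hq, outcome, payload, stepRun, Option.map_some,
            Option.isSome_none, Bool.false_eq_true, if_false] at h
          split_ifs at h with h3
          · cases h; exact ⟨h3, rfl⟩

theorem run_fin_of_halt_true {t : ℕ} {v : V} (h : core π l t v = .halt true) :
    ∃ s < t, ∃ r, core π l s v = .run r ∧ r.fin = true := by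
  induction t with
  | zero => simp [core_zero] at h
  | succ t ih =>
    rw [core_succ] at h
    cases hc : core π l t v with
    | halt b =>
      rw [hc] at h
      simp only [next] at h
      obtain ⟨s, hs, h⟩ := ih (hc.trans h)
      exact ⟨s, by omega, h⟩
    | err => simp [hc, next] at h
    | run r =>
      refine ⟨t, by omega, r, hc, ?_⟩
      rw [hc] at h
      simp only [next] at h
      split_ifs at h with h1 h2
      · exact h1
      · split at h
        · simp at h
        all_goals
          simp only [stepRun] at h
          split_ifs at h

/-- The facts about a vertex which is running after `t` rounds. -/
structure Sane (t : ℕ) (v : V) (r : Rec) : Prop where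
  eq : r = ideal G (lab l) t v
  good : 1 ≤ t → GoodAt G (lab l) v
  par_run : ∀ s < t, ∀ u, par G (lab l) v = some u →
    core π l s u = .run (ideal G (lab l) s u)
  self_run : ∀ s < t, core π l s v = .run (ideal G (lab l) s v)
  fin : ∀ s < t, (ideal G (lab l) s v).fin = false
  check : ∀ s < t, Check (lab l v) (ideal G (lab l) s v)
    ((par G (lab l) v).map (ideal G (lab l) s))

/-- A parent in error would have put its child into error, and a finished parent would have finished
it; so running at `t + 1` forces the parent to run at `t`, and the induction applies to the parent.
-/
theorem sane_of_run (t : ℕ) : ∀ (v : V) (r : Rec), core π l t v = .run r → Sane π l t v r := by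
  induction t using Nat.strong_induction_on with
  | _ t ih =>
  intro v r h
  cases t with
  | zero =>
    rw [core_zero] at h
    cases h
    exact ⟨rfl, by simp, by simp, by simp, by simp, by simp⟩
  | succ t =>
    obtain ⟨r', hr', hfin, h0, hg⟩ := next_good_of_run π l h
    have S := ih t (Nat.lt_succ_self t) v r' hr'
    have hgood : GoodAt G (lab l) v := by
      rcases Nat.eq_zero_or_pos t with rfl | ht
      · exact h0 rfl
      · exact S.good ht
    obtain ⟨herr, hstep⟩ := hg hgood
    have hfin' : ∀ s < t + 1, (ideal G (lab l) s v).fin = false := fun s hs => by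
      rcases Nat.lt_succ_iff_lt_or_eq.1 hs with hs | rfl
      · exact S.fin s hs
      · rw [← S.eq]; exact hfin
    have hpar : ∀ u, par G (lab l) v = some u →
        core π l t u = .run (ideal G (lab l) t u) := by
      intro u hu
      cases hc : core π l t u with
      | run q => rw [(ih t (Nat.lt_succ_self t) u q hc).eq]
      | err => exact absurd hc (herr u hu)
      -- An unfinished running vertex never halts directly, and the parent was unfinished one round
      -- ago since otherwise `v` would be finished now.
      | halt b =>
        exfalso
        cases t with
        | zero => simp [core_zero] at hc
        | succ t =>
          have hrun := S.par_run t (Nat.lt_succ_self t) u hu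
          have hf : (ideal G (lab l) t u).fin = false := by
            by_contra hf
            have := ideal_fin_succ hu (by simpa using hf)
            rw [hfin' _ (by omega)] at this
            cases this
          rw [core_succ, hrun] at hc
          simp only [next, hf, Bool.false_eq_true, if_false] at hc
          split_ifs at hc
          · split at hc
            · simp at hc
            all_goals
              simp only [stepRun] at hc
              split_ifs at hc
    have hnew := hstep ((par G (lab l) v).map (ideal G (lab l) t))
      (fun u hu => ⟨_, hpar u hu, by simp [hu]⟩) (fun hn => by simp [hn])
    refine ⟨?_, fun _ => hgood, ?_, ?_, hfin', ?_⟩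
    · rw [hnew.2, S.eq, ideal]
    · intro s hs u hu
      rcases Nat.lt_succ_iff_lt_or_eq.1 hs with hs | rfl
      · exact S.par_run s hs u hu
      · exact hpar u hu
    · intro s hs
      rcases Nat.lt_succ_iff_lt_or_eq.1 hs with hs | rfl
      · exact S.self_run s hs
      · rw [hr', S.eq]
    · intro s hs
      rcases Nat.lt_succ_iff_lt_or_eq.1 hs with hs | rfl
      · exact S.check s hs
      · rw [← S.eq]; exact hnew.1

/-- Without defects all vertices behave ideally. -/
theorem core_eq_ideal (hgood : ∀ v, GoodAt G (lab l) v) (t : ℕ)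
    (hcheck : ∀ s < t, ∀ v, (∀ s' ≤ s, (ideal G (lab l) s' v).fin = false) →
      Check (lab l v) (ideal G (lab l) s v) ((par G (lab l) v).map (ideal G (lab l) s))) (v : V) :
    (core π l t v = .run (ideal G (lab l) t v) ∧ ∀ s < t, (ideal G (lab l) s v).fin = false) ∨
      (core π l t v = .halt true ∧ ∃ s < t, (ideal G (lab l) s v).fin = true) := by
  induction t generalizing v with
  | zero => exact Or.inl ⟨core_zero π l v, by simp⟩
  | succ t ih =>
    have ih := ih fun s hs => hcheck s (by omega)
    rw [core_succ]
    rcases ih v with ⟨hv, hf⟩ | ⟨hv, s, hs, hf⟩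
    · rw [hv]
      cases hft : (ideal G (lab l) t v).fin with
      | true => exact Or.inr ⟨by simp [next, hft], t, by omega, hft⟩
      | false =>
        have hf' : ∀ s < t + 1, (ideal G (lab l) s v).fin = false := fun s hs => by
          rcases Nat.lt_succ_iff_lt_or_eq.1 hs with hs | rfl
          · exact hf s hs
          · exact hft
        refine Or.inl ⟨?_, hf'⟩
        have hc := hcheck t (by omega) v fun s hs => hf' s (by omega)
        rw [gather_good π l (hgood v)]
        cases hp : par G (lab l) v with
        | none =>
          rw [hp] at hc
          simp only [next, hft, ideal, hp, stepRun]
          simp only [Option.map_none] at hc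
          simp [hc]
        | some u =>
          have hu : core π l t u = .run (ideal G (lab l) t u) := by
            rcases ih u with ⟨h, -⟩ | ⟨-, s, hs, hfs⟩
            · exact h
            · have := ideal_fin_succ hp hfs
              rw [hf' _ (by omega)] at this
              cases this
          rw [hp] at hc
          simp only [Option.map_some] at hc
          simp [next, hft, ideal, hp, stepRun, msg, hu, outcome, payload, hc]
    · exact Or.inr ⟨by rw [hv]; rfl, s, by omega, hf⟩

end Dynamics

/-! ### Leader election along a chain -/

section Election

open scoped Classical in
/-- State of the election when a phase with leader set `S` begins. -/
noncomputable def phaseStart (S : ℕ → Prop) (col c : ℕ → Bool) (x : ℕ) :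
    Option Bool × Option (Bool × Bool) :=
  if S x then (some (col x), some (col x, c x)) else (none, none)

variable {N T m : ℕ} {e : ℕ → ℕ → Option Bool × Option (Bool × Bool)} {c col : ℕ → Bool}
  {S : ℕ → Prop}

/-- During a phase the leaders are frozen and the tokens shift by one vertex per round, because with
gaps of at least `m` no leader meets a token early. The recursion is assumed only for `x + t < N`:
on a ring `N` is arbitrary, on a path it is the depth. -/
theorem elect_phase
    (hrec : ∀ t x, x + t < N → e (t + 1) x = electStep (c x) (e t x).1 (e t (x + 1)).2)
    (hT : ∀ x, x + T ≤ N → e T x = phaseStart S col c x)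
    (gap : ∀ x i, x + i ≤ N → S x → 0 < i → i < m → ¬ S (x + i)) (i : ℕ) (hi : i < m) :
    ∀ x, x + T + i ≤ N →
      e (T + i) x = ((phaseStart S col c x).1, (phaseStart S col c (x + i)).2) := by
  induction i with
  | zero => exact fun x hx => hT x hx
  | succ i ih =>
    intro x hx
    have ih := ih (by omega)
    rw [← add_assoc, hrec _ _ (by omega), ih x (by omega), ih (x + 1) (by omega),
      show x + 1 + i = x + (i + 1) by ring]
    by_cases hS : S x
    · have h1 := gap x (i + 1) (by omega) hS (by omega) hi
      cases hc : col x <;> simp [phaseStart, hS, h1, electStep]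
    · simp [phaseStart, hS, electStep]

/-- By `hper` the next leader is exactly `m` away, so every leader meets a token in the last round
of the phase. -/
theorem elect_phase_end
    (hrec : ∀ t x, x + t < N → e (t + 1) x = electStep (c x) (e t x).1 (e t (x + 1)).2)
    (hT : ∀ x, x + T ≤ N → e T x = phaseStart S col c x) (hm : 0 < m)
    (gap : ∀ x i, x + i ≤ N → S x → 0 < i → i < m → ¬ S (x + i))
    (hper : ∀ x, x + m ≤ N → (S x ↔ S (x + m))) (x : ℕ) (hx : x + (T + m) ≤ N) :
    e (T + m) x =
      phaseStart (fun x => S x ∧ col x = false) (fun x => c (x + m)) c x := by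
  obtain ⟨i, rfl⟩ := Nat.exists_eq_succ_of_ne_zero hm.ne'
  have h1 := elect_phase hrec hT gap i (by omega)
  rw [show T + i.succ = T + i + 1 by omega, hrec _ _ (by omega), h1 x (by omega),
    h1 (x + 1) (by omega), show x + 1 + i = x + i.succ by omega]
  have h2 := hper x (by omega)
  by_cases hS : S x
  · have h3 := h2.1 hS
    cases hc : col x <;> simp [phaseStart, hS, h3, hc, electStep]
  · have h3 : ¬ S (x + i.succ) := fun h => hS (h2.2 h)
    simp only [phaseStart, hS, h3, electStep, if_false, false_and]

theorem electOk_of_phase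
    (hrec : ∀ t x, x + t < N → e (t + 1) x = electStep (c x) (e t x).1 (e t (x + 1)).2)
    (hT : ∀ x, x + T ≤ N → e T x = phaseStart S col c x)
    (gap : ∀ x i, x + i ≤ N → S x → 0 < i → i < m → ¬ S (x + i)) {i : ℕ} (hi : i < m) {x : ℕ}
    (hx : x + T + i < N) (halt : x + m ≤ N → S x → col x ≠ col (x + m)) :
    ElectOk (e (T + i) x).1 (e (T + i) (x + 1)).2 := by
  have h1 := elect_phase hrec hT gap i hi
  rw [h1 x (by omega), h1 (x + 1) (by omega), show x + 1 + i = x + (i + 1) by omega]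
  intro y z d hy hz
  by_cases hS : S x
  · by_cases him : i + 1 = m
    · rw [him] at hz
      by_cases hS' : S (x + m)
      · simp only [phaseStart, hS, if_true, Option.some.injEq] at hy
        simp only [phaseStart, hS', if_true, Option.some.injEq, Prod.mk.injEq] at hz
        rw [← hy, ← hz.1]
        exact halt (by omega) hS
      · simp [phaseStart, hS'] at hz
    · have h2 := gap x (i + 1) (by omega) hS (by omega) (by omega)
      simp [phaseStart, h2] at hz
  · simp [phaseStart, hS] at hy

theorem color_ne_of_electOk
    (hrec : ∀ t x, x + t < N → e (t + 1) x = electStep (c x) (e t x).1 (e t (x + 1)).2)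
    (hT : ∀ x, x + T ≤ N → e T x = phaseStart S col c x)
    (gap : ∀ x i, x + i ≤ N → S x → 0 < i → i < m → ¬ S (x + i)) (hm : 0 < m) {x : ℕ}
    (hx : x + T + m ≤ N) (hS : S x) (hS' : S (x + m))
    (hok : ElectOk (e (T + (m - 1)) x).1 (e (T + (m - 1)) (x + 1)).2) :
    col x ≠ col (x + m) := by
  have h1 := elect_phase hrec hT gap (m - 1) (by omega)
  rw [h1 x (by omega), h1 (x + 1) (by omega), show x + 1 + (m - 1) = x + m by omega] at hok
  exact hok _ _ (c (x + m)) (by simp [phaseStart, hS]) (by simp [phaseStart, hS'])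

/-- On a ring of `p` vertices the election fails within `2 p` rounds. -/
theorem election_fails {p B : ℕ} (hp : 0 < p) (hB : 2 * p ≤ B) {p0 : ℕ → Bool}
    (h0 : ∀ x, e 0 x = (some (p0 x), some (p0 x, c x)))
    (hrec : ∀ t x, e (t + 1) x = electStep (c x) (e t x).1 (e t (x + 1)).2)
    (hper : ∀ t x, e t (x + p) = e t x)
    (hok : ∀ t < B, ∀ x, ElectOk (e t x).1 (e t (x + 1)).2) : False := by
  have key : ∀ k : ℕ, 2 ^ k ≤ B → ∃ (S : ℕ → Prop) (col : ℕ → Bool),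
      (∀ x, e (2 ^ k - 1) x = phaseStart S col c x) ∧
      (∀ x i, S x → 0 < i → i < 2 ^ k → ¬ S (x + i)) ∧ (∀ x, S x ↔ S (x + 2 ^ k)) ∧
      ∃ x, S x := by
    intro k
    induction k with
    | zero =>
      intro _
      refine ⟨fun _ => True, p0, fun x => by simp [phaseStart, h0], fun x i _ h1 h2 => ?_,
        by simp, ⟨0, trivial⟩⟩
      simp at h2; omega
    | succ k ih =>
      intro hk
      have hk2 : 2 ^ (k + 1) = 2 ^ k + 2 ^ k := by ring
      have hpos : 0 < 2 ^ k := by positivity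
      obtain ⟨S, col, hT, gap, hS, x0, hx0⟩ := ih (by omega)
      have halt : ∀ x, S x → col x ≠ col (x + 2 ^ k) := fun x hx =>
        color_ne_of_electOk (N := x + (2 ^ k - 1) + 2 ^ k) (fun t x _ => hrec t x)
          (fun x _ => hT x) (fun x i _ => gap x i) hpos le_rfl hx ((hS x).1 hx)
          (hok _ (by omega) x)
      refine ⟨fun x => S x ∧ col x = false, fun x => c (x + 2 ^ k), fun x => ?_, ?_, ?_, ?_⟩
      · rw [hk2, show 2 ^ k + 2 ^ k - 1 = (2 ^ k - 1) + 2 ^ k by omega]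
        exact elect_phase_end (N := x + ((2 ^ k - 1) + 2 ^ k)) (fun t x _ => hrec t x)
          (fun x _ => hT x) hpos (fun x i _ => gap x i) (fun x _ => hS x) x le_rfl
      · rintro x i ⟨hx, hcx⟩ hi hik ⟨hxi, hci⟩
        rcases lt_trichotomy i (2 ^ k) with h | rfl | h
        · exact gap x i hx hi h hxi
        · exact halt x hx (hcx.trans hci.symm)
        · refine gap (x + 2 ^ k) (i - 2 ^ k) ((hS x).1 hx) (by omega) (by omega) ?_
          rwa [show x + 2 ^ k + (i - 2 ^ k) = x + i by omega]
      · intro x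
        -- Colours alternate, so the leader two gaps further has the same colour and survives
        -- together with `x`.
        have h1 := hS x
        have h2 := hS (x + 2 ^ k)
        rw [hk2, ← add_assoc]
        constructor
        · rintro ⟨hx, hcx⟩
          have h3 := Bool.eq_not_iff.2 (halt x hx).symm
          have h4 := Bool.eq_not_iff.2 (halt _ (h1.1 hx)).symm
          exact ⟨h2.1 (h1.1 hx), by rw [h4, h3, hcx]; rfl⟩
        · rintro ⟨hx, hcx⟩
          have h3 := Bool.eq_not_iff.2 (halt x (h1.2 (h2.2 hx))).symm
          have h4 := Bool.eq_not_iff.2 (halt _ (h2.2 hx)).symm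
          rw [h4, h3, Bool.not_not] at hcx
          exact ⟨h1.2 (h2.2 hx), hcx⟩
      · cases hc : col x0 with
        | false => exact ⟨x0, hx0, hc⟩
        | true =>
          have h3 := Bool.eq_not_iff.2 (halt x0 hx0).symm
          exact ⟨x0 + 2 ^ k, (hS x0).1 hx0, by rw [h3, hc]; rfl⟩
  have hlt : p < 2 ^ (Nat.log 2 p + 1) := Nat.lt_pow_succ_log_self (by norm_num) p
  have hle : 2 ^ Nat.log 2 p ≤ p := Nat.pow_log_le_self 2 hp.ne'
  -- This gap exceeds `p` but is at most `2 * p`, which is where `hB` enters. A leader and its own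
  -- copy `p` steps further are now too close.
  obtain ⟨S, col, hT, gap, -, x, hx⟩ := key (Nat.log 2 p + 1) (by rw [pow_succ]; omega)
  refine gap x p hx hp hlt ?_
  by_contra hxp
  have h1 := hper (2 ^ (Nat.log 2 p + 1) - 1) x
  rw [hT, hT] at h1
  simp [phaseStart, hx, hxp] at h1

end Election

/-! ### A counter without overflow is not periodic -/

section Counter

/-- Numbers written in blocks of equal length, increasing from block to block, cannot recur. -/
theorem counter_not_periodic {ℓ m : ℕ} (hℓ : 0 < ℓ) (hm : 0 < m) (b c : ℕ → ℕ → Bool)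
    (hc : ∀ k s, c (k + m) s = c k s)
    (hlow : ∀ k, c k 0 = true)
    (hcarry : ∀ k s, s < ℓ → b k s = true → c k s = true → s + 1 < ℓ ∧ c k (s + 1) = true)
    (hstep : ∀ k s, s < ℓ → b k s = xor (b (k + 1) s) (c (k + 1) s)) : False := by
  classical
  -- `s` is the highest position that ever receives a carry. A carry there meets a 0, since a 1
  -- would pass it on to `s + 1`; superfluous carries do no harm.
  obtain ⟨s, ⟨hs, k, hk⟩, hmax⟩ : ∃ s, (s < ℓ ∧ ∃ k, c k s = true) ∧
      ∀ s', s < s' → ¬ (s' < ℓ ∧ ∃ k, c k s' = true) := by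
    have hne : ((Finset.range ℓ).filter fun s => ∃ k, c k s = true).Nonempty :=
      ⟨0, by simpa [hℓ] using ⟨0, hlow 0⟩⟩
    refine ⟨((Finset.range ℓ).filter fun s => ∃ k, c k s = true).max' hne, ?_,
      fun s' hs' h => ?_⟩
    · simpa using Finset.max'_mem _ hne
    · exact absurd (Finset.le_max' _ s' (by simpa using h)) (not_le.2 hs')
  have hz : ∀ k, c k s = true → b k s = false := fun k hk => by
    by_contra h
    obtain ⟨h1, h2⟩ := hcarry k s hs (by simpa using h) hk
    exact hmax (s + 1) (by omega) ⟨h1, k, h2⟩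
  -- Numbers grow as the index decreases. After the carry in block `k + m` the digit is 1 and stays
  -- so, down to block `k`, where it must be 0.
  have hdown : ∀ i, i < k + m → b (k + m - (i + 1)) s = true := by
    intro i
    induction i with
    | zero =>
      intro h
      have hck : c (k + m) s = true := by rw [hc, hk]
      have := hstep (k + m - 1) s hs
      rw [show k + m - 1 + 1 = k + m by omega, hck, hz _ hck] at this
      simpa using this
    | succ i ih =>
      intro h
      have ih := ih (by omega)
      have := hstep (k + m - (i + 1 + 1)) s hs
      rw [show k + m - (i + 1 + 1) + 1 = k + m - (i + 1) by omega, ih] at this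
      have hcf : c (k + m - (i + 1)) s = false := by
        by_contra h
        rw [hz _ (by simpa using h)] at ih
        cases ih
      rw [hcf] at this
      simpa using this
  have h1 := hdown (m - 1) (by omega)
  rw [show k + m - (m - 1 + 1) = k by omega, hz k hk] at h1
  cases h1

end Counter

/-! ### Consistent labels along a chain are not periodic -/

section Labels

/-- Along a chain of consistent labels all blocks have the same length. -/
theorem start_iff_of_chain {a : ℕ → Lab}
    (hloc : ∀ x, LocalOk (a x) (some (a (x + 1))))
    (hpart : ∀ x j, (a (x + j)).start = true → (∀ i < j, (a (x + i)).start = false) →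
      PartnerOk (a x) (a (x + (2 * j + 1))))
    (h0 : (a 0).start = true) {ℓ : ℕ} (hℓ : 0 < ℓ) (h1 : (a ℓ).start = true)
    (hbetween : ∀ r, 0 < r → r < ℓ → (a r).start = false) (k : ℕ) :
    (a (k * ℓ)).start = true ∧
      ∀ r, 0 < r → r < ℓ → (a (k * ℓ + r)).start = false := by
  have key : ∀ k, (a (k * ℓ)).start = true ∧ (a (k * ℓ + ℓ)).start = true ∧
      ∀ r, 0 < r → r < ℓ → (a (k * ℓ + r)).start = false := by
    intro k
    induction k with
    | zero => simpa [h0, h1] using hbetween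
    | succ k ih =>
      obtain ⟨ih0, ih1, ih2⟩ := ih
      -- Reflection in the start at `k * ℓ + ℓ`: `start` of a vertex is `last` of its parent, which
      -- is `start` of the partner of that parent.
      have hmirror : ∀ r, 0 < r → r ≤ ℓ →
          (a (k * ℓ + ℓ + r)).start = (a (k * ℓ + (ℓ - r))).start := by
        intro r hr hrl
        have hp := hpart (k * ℓ + (ℓ - (r - 1))) (r - 1)
          (by rwa [show k * ℓ + (ℓ - (r - 1)) + (r - 1) = k * ℓ + ℓ by omega])
          (fun i hi => by
            rw [add_assoc]
            exact ih2 _ (by omega) (by omega))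
        have hl := (hloc (k * ℓ + (ℓ - r))).start_eq _ rfl
        rw [show k * ℓ + (ℓ - r) + 1 = k * ℓ + (ℓ - (r - 1)) by omega] at hl
        rw [hl, hp.last_eq, show k * ℓ + (ℓ - (r - 1)) + (2 * (r - 1) + 1) = k * ℓ + ℓ + r by omega]
      rw [Nat.succ_mul]
      refine ⟨ih1, ?_, fun r hr hrl => ?_⟩
      · rw [hmirror ℓ hℓ le_rfl]
        simpa using ih0
      · rw [hmirror r hr hrl.le]
        exact ih2 _ (by omega) (by omega)
  exact ⟨(key k).1, (key k).2.2⟩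

theorem labels_not_periodic {a : ℕ → Lab} {p : ℕ} (hp : 0 < p) (hper : ∀ x, a (x + p) = a x)
    (hloc : ∀ x, LocalOk (a x) (some (a (x + 1))))
    (hpart : ∀ x j, (a (x + j)).start = true → (∀ i < j, (a (x + i)).start = false) →
      PartnerOk (a x) (a (x + (2 * j + 1))))
    (h0 : (a 0).start = true) : False := by
  classical
  have hex : ∃ ℓ, 0 < ℓ ∧ (a ℓ).start = true := ⟨p, hp, by
    have := hper 0
    rw [zero_add] at this
    rw [this, h0]⟩
  obtain ⟨ℓ, ⟨hℓ, h1⟩, hmin⟩ : ∃ ℓ, (0 < ℓ ∧ (a ℓ).start = true) ∧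
      ∀ r < ℓ, ¬ (0 < r ∧ (a r).start = true) :=
    ⟨Nat.find hex, Nat.find_spec hex, fun r hr => Nat.find_min hex hr⟩
  have hstart := start_iff_of_chain hloc hpart h0 hℓ h1
    (fun r hr hrl => by simpa [hr] using hmin r hrl)
  have hperk : ∀ k x, a (x + k * p) = a x := by
    intro k
    induction k with
    | zero => simp
    | succ k ih => intro x; rw [Nat.succ_mul, ← add_assoc, hper, ih]
  -- `f k j` is the label at offset `j` in the block number `k`
  let f : ℕ → ℕ → Lab := fun k j => a (k * ℓ + (ℓ - j))
  have hf0 : ∀ k, (f k 0).start = true := fun k => by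
    have := (hstart (k + 1)).1
    rwa [Nat.succ_mul] at this
  have hfs : ∀ k j, j + 1 < ℓ → (f k (j + 1)).start = false := fun k j hj =>
    (hstart k).2 _ (by omega) (by omega)
  have hfl : ∀ k j, j + 1 < ℓ → LocalOk (f k (j + 1)) (some (f k j)) := fun k j hj => by
    have := hloc (k * ℓ + (ℓ - (j + 1)))
    rwa [show k * ℓ + (ℓ - (j + 1)) + 1 = k * ℓ + (ℓ - j) by omega] at this
  have hlast : ∀ k, (f k (ℓ - 1)).last = true := fun k => by
    have := (hloc (k * ℓ)).start_eq _ rfl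
    rw [(hstart k).1] at this
    rw [this]
    exact congrArg (fun x => (a x).last) (by omega)
  have hfp : ∀ k j, j < ℓ → PartnerOk (f k j) (f (k + 1) (ℓ - 1 - j)) := fun k j hj => by
    have := hpart (k * ℓ + (ℓ - j)) j
      (by rw [show k * ℓ + (ℓ - j) + j = (k + 1) * ℓ by rw [Nat.succ_mul]; omega]
          exact (hstart (k + 1)).1)
      (fun i hi => by rw [add_assoc]; exact (hstart k).2 _ (by omega) (by omega))
    have e : (k + 1) * ℓ = k * ℓ + ℓ := by ring
    rwa [show k * ℓ + (ℓ - j) + (2 * j + 1) = (k + 1) * ℓ + (ℓ - (ℓ - 1 - j)) by omega] at this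
  have hflip : ∀ k j, j < ℓ → (f k j).flip = (f k 0).flip := by
    intro k j
    induction j with
    | zero => simp
    | succ j ih => intro hj; rw [(hfl k j hj).flip_eq _ rfl (hfs k j hj), ih (by omega)]
  have hflip' : ∀ k, (f (k + 1) 0).flip = !(f k 0).flip := fun k => by
    have := (hfp k 0 hℓ).flip_ne
    rw [hflip (k + 1) _ (by omega)] at this
    exact Bool.eq_not_iff.2 this.symm
  -- `p` blocks span `ℓ * p` labels, a multiple of the period, whether or not `ℓ` divides `p`.
  have hfper : ∀ k, f (k + p) = f k := fun k => funext fun j => by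
    show a ((k + p) * ℓ + (ℓ - j)) = _
    rw [show (k + p) * ℓ + (ℓ - j) = k * ℓ + (ℓ - j) + ℓ * p by ring, hperk]
  -- The offset of the digit of significance `s` in block `k`; alternating orientation sends it to
  -- the mirror offset in the next block.
  let idx : ℕ → ℕ → ℕ := fun k s => if (f k 0).flip then ℓ - 1 - s else s
  have hidx : ∀ k s, s < ℓ → idx (k + 1) s = ℓ - 1 - idx k s := fun k s hs => by
    simp only [idx, hflip' k]
    cases (f k 0).flip
    · simp
    · simp; omega
  have hidxlt : ∀ k s, s < ℓ → idx k s < ℓ := fun k s hs => by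
    simp only [idx]; split_ifs <;> omega
  refine counter_not_periodic hℓ hp (fun k s => (f k (idx k s)).bit)
    (fun k s => (f k (idx k s)).carry) (fun k s => by simp only [idx, hfper]) (fun k => ?_)
    (fun k s hs hb hc => ?_) (fun k s hs => ?_)
  · cases hφ : (f k 0).flip with
    | false =>
      have h := (hloc (k * ℓ + (ℓ - 0))).start_low (hf0 k) hφ
      rw [show idx k 0 = 0 by simp [idx, hφ]]
      exact h
    | true =>
      have h := (hloc (k * ℓ + (ℓ - (ℓ - 1)))).last_low (hlast k)
        ((hflip k _ (by omega)).trans hφ)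
      rw [show idx k 0 = ℓ - 1 by simp [idx, hφ]]
      exact h
  · cases hφ : (f k 0).flip with
    | false =>
      simp only [idx, hφ, Bool.false_eq_true, if_false] at hb hc ⊢
      have hs1 : s + 1 < ℓ := by
        by_contra hcon
        obtain rfl : s = ℓ - 1 := by omega
        have h := (hloc (k * ℓ + (ℓ - (ℓ - 1)))).last_high (hlast k)
          ((hflip k _ (by omega)).trans hφ) hb
        exact absurd (hc.symm.trans h) (by simp)
      exact ⟨hs1, (hfl k s hs1).carry_down _ rfl (hfs k s hs1) ((hflip k _ hs1).trans hφ) hb hc⟩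
    | true =>
      simp only [idx, hφ, if_true] at hb hc ⊢
      have hs1 : s + 1 < ℓ := by
        by_contra hcon
        obtain rfl : s = ℓ - 1 := by omega
        rw [Nat.sub_self] at hb hc
        have h := (hloc (k * ℓ + (ℓ - 0))).start_high (hf0 k) hφ hb
        exact absurd (hc.symm.trans h) (by simp)
      refine ⟨hs1, ?_⟩
      obtain ⟨j, hj⟩ : ∃ j, ℓ - 1 - s = j + 1 := ⟨ℓ - 1 - s - 1, by omega⟩
      rw [hj] at hb hc
      rw [show ℓ - 1 - (s + 1) = j by omega]
      exact (hfl k j (by omega)).carry_up _ rfl (hfs k j (by omega))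
        ((hflip k _ (by omega)).trans hφ) hb hc
  · have h := (hfp k (idx k s) (hidxlt k s hs)).bit_eq
    rw [← hidx k s hs] at h
    exact h

end Labels

/-! ### The ideal memory along an ancestor chain -/

section Chain

variable {V : Type} {G : SimpleGraph V} {lb : V → Lab}

/-- The vertex `v` is at offset `j` in its block. -/
def Offset (G : SimpleGraph V) (lb : V → Lab) : ℕ → V → Prop
  | 0, v => (lb v).start = true
  | j + 1, v => (lb v).start = false ∧ ∃ u, par G lb v = some u ∧ Offset G lb j u

def slowAt (t j : ℕ) : Slow :=
  if t < 2 * j then .wait else if t = 2 * j then .now else if t = 2 * j + 1 then .send else .done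

theorem pulse_eq (r : Rec) : pulse (some r) = true ↔ r.slow = .send := by
  obtain ⟨_, _, _, s, _, _, _⟩ := r
  cases s <;> simp [pulse]

/-- The signal spends one round in `now` and one in `send` at each vertex, so it reaches offset `j`
in round `2 * j`, just when the parent offers the label of ancestor `2 * j + 1`. -/
theorem ideal_slow (t : ℕ) : ∀ (j : ℕ) (v : V), Offset G lb j v →
    (ideal G lb t v).slow = slowAt t j := by
  induction t with
  | zero =>
    intro j v h
    cases j with
    | zero =>
      change (lb v).start = true at h
      simp [ideal, initRec, h, slowAt]
    | succ j => simp [ideal, initRec, h.1, slowAt]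
  | succ t ih =>
    intro j v h
    have hs := ih j v h
    simp only [ideal, clean, hs]
    cases j with
    | zero =>
      rcases t with _ | _ | t <;> simp [slowAt, slowStep]
    | succ j =>
      obtain ⟨-, u, hu, hj⟩ := h
      have hp : pulse (((par G lb v).map (ideal G lb t))) = true ↔ t = 2 * j + 1 := by
        rw [hu, Option.map_some, pulse_eq, ih j u hj]
        unfold slowAt
        split_ifs <;> simp <;> omega
      by_cases h1 : t < 2 * (j + 1)
      · simp only [slowAt, h1, if_true, slowStep]
        by_cases h2 : t = 2 * j + 1
        · rw [if_pos (hp.2 h2), if_neg (by omega), if_pos (by omega)]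
        · rw [if_neg (fun h => h2 (hp.1 h)), if_pos (by omega)]
      · by_cases h2 : t = 2 * (j + 1)
        · subst h2; simp [slowAt, slowStep]
        · by_cases h3 : t = 2 * (j + 1) + 1
          · subst h3
            have e : slowAt (2 * (j + 1) + 1 + 1) (j + 1) = .done := by
              unfold slowAt
              rw [if_neg (by omega), if_neg (by omega), if_neg (by omega)]
            rw [e]
            simp [slowAt, slowStep]
          · have e1 : slowAt t (j + 1) = .done := by
              unfold slowAt; rw [if_neg h1, if_neg h2, if_neg h3]
            have e2 : slowAt (t + 1) (j + 1) = .done := by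
              unfold slowAt
              rw [if_neg (by omega), if_neg (by omega), if_neg (by omega)]
            rw [e1, e2]
            rfl

variable {y : ℕ → V}

theorem ideal_item_chain (hy : ∀ x, par G lb (y x) = some (y (x + 1))) (t x : ℕ) :
    (ideal G lb t (y x)).item = some (lb (y (x + t))) := by
  induction t generalizing x with
  | zero => rfl
  | succ t ih => simp [ideal, clean, hy, ih, add_assoc, add_comm 1 t]

theorem ideal_seen_chain (hy : ∀ x, par G lb (y x) = some (y (x + 1))) (t x : ℕ) :
    (ideal G lb t (y x)).seen = true ↔ ∃ i ≤ t, (lb (y (x + i))).start = true := by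
  induction t with
  | zero => simp [ideal, initRec]
  | succ t ih =>
    have h := ideal_item_chain hy t (x + 1)
    simp only [ideal, clean, hy, Bool.or_eq_true, ih, Option.map_some, Option.bind_some, h,
      isStart, Option.any_some]
    rw [show x + 1 + t = x + (t + 1) by ring]
    constructor
    · rintro (⟨i, hi, h⟩ | h)
      · exact ⟨i, by omega, h⟩
      · exact ⟨t + 1, le_rfl, h⟩
    · rintro ⟨i, hi, h⟩
      rcases Nat.lt_or_eq_of_le hi with hi | rfl
      · exact Or.inl ⟨i, by omega, h⟩
      · exact Or.inr h

theorem ideal_fin_chain (hy : ∀ x, par G lb (y x) = some (y (x + 1))) (t x : ℕ) :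
    (ideal G lb (t + 1) (y x)).fin = true ↔
      (lb (y (x + (t + 1)))).start = true ∧ ∃ i ≤ t, (lb (y (x + i))).start = true := by
  have h := ideal_item_chain hy t (x + 1)
  rw [← ideal_seen_chain hy]
  simp only [ideal, clean, hy, Option.map_some, Option.bind_some, h, isStart, Option.any_some]
  rw [show x + 1 + t = x + (t + 1) by ring]
  simp

theorem offset_chain (hy : ∀ x, par G lb (y x) = some (y (x + 1))) (j x : ℕ)
    (h : (lb (y (x + j))).start = true) (hlt : ∀ i < j, (lb (y (x + i))).start = false) :
    Offset G lb j (y x) := by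
  induction j generalizing x with
  | zero => exact h
  | succ j ih =>
    refine ⟨hlt 0 (by omega), y (x + 1), hy x, ih (x + 1) ?_ fun i hi => ?_⟩
    · rwa [show x + 1 + j = x + (j + 1) by ring]
    · rw [show x + 1 + i = x + (i + 1) by ring]; exact hlt _ (by omega)

theorem ideal_elect_chain (hy : ∀ x, par G lb (y x) = some (y (x + 1))) (t x : ℕ) :
    ((ideal G lb (t + 1) (y x)).lead, (ideal G lb (t + 1) (y x)).tok) =
      electStep (lb (y x)).next (ideal G lb t (y x)).lead (ideal G lb t (y (x + 1))).tok := by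
  simp [ideal, clean, hy]

end Chain

/-! ### Cycles of the graph and infinite ancestor chains -/

section Ancestors

variable {V : Type} {G : SimpleGraph V} {lb : V → Lab}

/-- The `i`-th ancestor of `v`. -/
noncomputable def anc (G : SimpleGraph V) (lb : V → Lab) (v : V) : ℕ → Option V
  | 0 => some v
  | i + 1 => (anc G lb v i).bind (par G lb)

theorem anc_succ_of_par {u v : V} (h : par G lb v = some u) (i : ℕ) :
    anc G lb v (i + 1) = anc G lb u i := by
  induction i with
  | zero => simp [anc, h]
  | succ i ih => rw [anc, ih]; rfl

/-- If all edges join a child to its parent and there is a cycle, then some vertex has infinitely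
many ancestors. -/
theorem exists_infinite_chain (hgood : ∀ v, GoodAt G lb v) (hG : ¬ G.IsAcyclic) :
    ∃ y : ℕ → V, ∀ x, par G lb (y x) = some (y (x + 1)) := by
  classical
  by_cases hex : ∃ v, ∀ i, anc G lb v i ≠ none
  · obtain ⟨v, hv⟩ := hex
    choose y hy using fun i => Option.ne_none_iff_exists'.1 (hv i)
    refine ⟨y, fun x => ?_⟩
    have := hy (x + 1)
    rwa [anc, hy x, Option.bind_some] at this
  · exfalso
    push Not at hex
    -- The number of ancestors is a height that drops from child to parent. On a cycle of the graph,
    -- a vertex of maximal height would have both its cycle neighbours as parents.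
    have hlt : ∀ u v, par G lb v = some u → Nat.find (hex u) < Nat.find (hex v) := by
      intro u v h
      have hv := Nat.find_spec (hex v)
      cases hk : Nat.find (hex v) with
      | zero => rw [hk] at hv; cases hv
      | succ k =>
        rw [hk, anc_succ_of_par h] at hv
        exact Nat.lt_succ_of_le (Nat.find_min' _ hv)
    have hcol : ∀ a b : ZMod 3, a ≠ b → a + 1 = b ∨ b + 1 = a := by decide
    refine hG fun v c hc => ?_
    obtain ⟨w, hw, hmax⟩ := c.support.toFinset.exists_max_image (fun u => Nat.find (hex u))
      ⟨v, by simp⟩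
    rw [List.mem_toFinset] at hw
    have hc' := (SimpleGraph.Walk.isCycle_rotate hw).2 hc
    have hpar : ∀ u, G.Adj w u → u ∈ (c.rotate w hw).support → par G lb w = some u := by
      intro u ha hu
      have hu' : u ∈ c.support := by
        simpa using hu
      rcases hcol _ _ ((hgood w).ne u ha) with h | h
      · exact par_of_adj (hgood w) ha h
      · have := hlt w u (par_of_adj (hgood u) ha.symm h)
        have := hmax u (by simpa using hu')
        omega
    have h1 := hpar _ ((c.rotate w hw).adj_snd hc'.not_nil) (SimpleGraph.Walk.getVert_mem_support _ _)
    have h2 := hpar _ ((c.rotate w hw).adj_penultimate hc'.not_nil).symm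
      (SimpleGraph.Walk.getVert_mem_support _ _)
    exact hc'.snd_ne_penultimate (Option.some.inj (h1.symm.trans h2))

theorem chain_periodic {y : ℕ → V} (hy : ∀ x, par G lb (y x) = some (y (x + 1))) {i j : ℕ}
    (h : y i = y j) (x : ℕ) : y (i + x) = y (j + x) := by
  induction x with
  | zero => exact h
  | succ x ih =>
    have h1 := hy (i + x)
    rw [ih, hy] at h1
    exact (Option.some.inj h1).symm

end Ancestors

/-! ### Soundness and termination on arbitrary labels -/

section Soundness

variable {V : Type} [DecidableEq V] {G : SimpleGraph V} (π : PortOrder G)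
  (l : verifier.Labeling V)

theorem core_halt_mono {s t : ℕ} (hst : s ≤ t) {v : V} {b : Bool}
    (h : core π l s v = .halt b) : core π l t v = .halt b := by
  induction t, hst using Nat.le_induction with
  | base => exact h
  | succ t _ ih => rw [core_succ, ih]; rfl

theorem outcome_isSome_of_not_run {t : ℕ} {v : V} (h : ∀ r, core π l t v ≠ .run r) :
    (outcome (core π l (t + 1) v)).isSome = true := by
  rw [core_succ]
  cases hc : core π l t v with
  | run r => exact absurd hc (h r)
  | err => rfl
  | halt b => rfl

theorem not_all_accept [Finite V] (hG : ¬ G.IsAcyclic) {T : ℕ}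
    (h : ∀ v, core π l T v = .halt true) : False := by
  have hS : ∀ v, ∃ s, GoodAt G (lab l) v ∧ (ideal G (lab l) (s + 1) v).fin = true ∧
      ∀ t ≤ s, Check (lab l v) (ideal G (lab l) t v)
        ((par G (lab l) v).map (ideal G (lab l) t)) := by
    intro v
    obtain ⟨s, -, r, hr, hfin⟩ := run_fin_of_halt_true π l (h v)
    have S := sane_of_run π l s v r hr
    cases s with
    | zero => rw [S.eq] at hfin; cases hfin
    | succ s =>
      exact ⟨s, S.good (by omega), S.eq ▸ hfin, fun t ht => S.check t (by omega)⟩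
  obtain ⟨y, hy⟩ := exists_infinite_chain (fun v => (hS v).choose_spec.1) hG
  obtain ⟨i, j, hij, heq⟩ := Finite.exists_ne_map_eq_of_infinite y
  wlog hlt : i < j generalizing i j
  · exact this j i hij.symm heq.symm (by omega)
  have hper := chain_periodic hy heq
  have hpart : ∀ x, LocalOk (lab l (y x)) (some (lab l (y (x + 1)))) ∧
      (∃ k ≥ x, (lab l (y k)).start = true) ∧
      ∀ k, (lab l (y (x + k))).start = true → (∀ i < k, (lab l (y (x + i))).start = false) →
        PartnerOk (lab l (y x)) (lab l (y (x + (2 * k + 1)))) := by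
    intro x
    obtain ⟨s, -, hfin, hchk⟩ := hS (y x)
    rw [ideal_fin_chain hy] at hfin
    obtain ⟨hfin, k', hk', hseen⟩ := hfin
    have hitem : ∀ t, ((par G (lab l) (y x)).map (ideal G (lab l) t)).bind Rec.item =
        some (lab l (y (x + (t + 1)))) := fun t => by
      rw [hy, Option.map_some, Option.bind_some, ideal_item_chain hy,
        show x + 1 + t = x + (t + 1) by ring]
    refine ⟨?_, ⟨x + (s + 1), by omega, hfin⟩, fun k hk hlt => ?_⟩
    · have := (hchk 0 (by omega)).loc rfl
      rwa [hitem] at this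
    · have hoff := offset_chain hy k x hk hlt
      have hmet := (hchk s le_rfl).met
      rw [hitem, ideal_slow s k _ hoff] at hmet
      -- The check `met` ensures that the slow signal came before the vertex finished, so the
      -- partner check in round `2 * k` did take place.
      have hks : 2 * k ≤ s := by
        by_contra hcon
        refine hmet (by simpa [isStart] using hfin)
          ((ideal_seen_chain hy s x).2 ⟨k', hk', hseen⟩) ?_
        rw [slowAt, if_pos (by omega)]
      have hp := (hchk (2 * k) hks).partner
      rw [hitem, ideal_slow _ k _ hoff] at hp
      exact hp (by simp [slowAt]) _ rfl
  -- Acceptance of `y i` supplies a start at an index at least `i`, that is, in the periodic part of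
  -- the chain.
  obtain ⟨k, hk, hstart⟩ := (hpart i).2.1
  refine labels_not_periodic (a := fun x => lab l (y (k + x))) (p := j - i) (by omega)
    (fun x => ?_) (fun x => (hpart (k + x)).1) (fun x m hm hlt => ?_) hstart
  · have := hper (k + x - i)
    rw [show i + (k + x - i) = k + x by omega,
      show j + (k + x - i) = k + (x + (j - i)) by omega] at this
    exact congrArg (lab l) this.symm
  · simp only [← add_assoc] at hm hlt ⊢
    exact (hpart (k + x)).2.2 m hm hlt

/-- If `v` runs in round `6 n - 1`, its `i`-th ancestor runs in round `6 n - 1 - i`. The ancestors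
close up to a cycle of length `p` within `n` steps, all of whose vertices still run after round `2 *
p`. A start on the cycle would have finished by round `p`; without starts the election would have
failed. -/
theorem halts_of_six_mul_card [Fintype V] (v : V) :
    (outcome (core π l (6 * Fintype.card V) v)).isSome = true := by
  have hn : 0 < Fintype.card V := Fintype.card_pos_iff.2 ⟨v⟩
  set n := Fintype.card V with hndef
  obtain ⟨T, hT⟩ : ∃ T, 6 * n = T + 1 := ⟨6 * n - 1, by omega⟩
  rw [hT]
  refine outcome_isSome_of_not_run π l fun r hr => ?_
  have hrun : ∀ i ≤ T, ∀ u, anc G (lab l) v i = some u →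
      ∃ r, core π l (T - i) u = .run r := by
    intro i
    induction i with
    | zero =>
      intro _ u hu
      simp only [anc, Option.some.injEq] at hu
      exact ⟨r, hu ▸ hr⟩
    | succ i ih =>
      intro hi u hu
      obtain ⟨w, hw, hwu⟩ := Option.bind_eq_some_iff.1 hu
      obtain ⟨q, hq⟩ := ih (by omega) w hw
      exact ⟨_, (sane_of_run π l _ _ _ hq).par_run (T - (i + 1)) (by omega) u hwu⟩
  have hsome : ∀ i < T, ∃ u, anc G (lab l) v i = some u := by
    intro i
    induction i with
    | zero => exact fun _ => ⟨v, rfl⟩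
    | succ i ih =>
      intro hi
      obtain ⟨u, hu⟩ := ih (by omega)
      obtain ⟨q, hq⟩ := hrun i (by omega) u hu
      cases hp : par G (lab l) u with
      | some w => exact ⟨w, by rw [anc, hu, Option.bind_some, hp]⟩
      | none =>
        -- A vertex without parent is finished after one round.
        have := (sane_of_run π l _ _ _ hq).fin 1 (by omega)
        simp [ideal, clean, hp] at this
  obtain ⟨i, j, hij, hj, heq⟩ : ∃ i j, i < j ∧ j ≤ n ∧
      anc G (lab l) v i = anc G (lab l) v j := by
    choose f hf using fun i : Fin (n + 1) => hsome i (by omega)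
    obtain ⟨a, b, hab, h⟩ := Fintype.exists_ne_map_eq_of_card_lt f (by simp [← hndef])
    rcases lt_or_gt_of_ne hab with hab | hab
    · exact ⟨a, b, hab, by omega, by rw [hf, hf, h]⟩
    · exact ⟨b, a, hab, by omega, by rw [hf, hf, h]⟩
  have hshift : ∀ x, anc G (lab l) v (i + x) = anc G (lab l) v (j + x) := by
    intro x
    induction x with
    | zero => exact heq
    | succ x ih => rw [← add_assoc, ← add_assoc, anc, anc, ih]
  obtain ⟨p, hp⟩ : ∃ p, j = i + p := ⟨j - i, by omega⟩
  have hp0 : 0 < p := by omega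
  have hmod : ∀ x, anc G (lab l) v (i + x) = anc G (lab l) v (i + x % p) := by
    intro x
    induction x using Nat.strong_induction_on with
    | _ x ih =>
      by_cases hx : x < p
      · rw [Nat.mod_eq_of_lt hx]
      · have h1 := hshift (x - p)
        rw [hp, show i + p + (x - p) = i + x by omega] at h1
        rw [← h1, ih (x - p) (by omega), ← Nat.mod_eq_sub_mod (by omega)]
  choose z hz using fun x => hsome (i + x % p) (by have := Nat.mod_lt x hp0; omega)
  have hz' : ∀ x, anc G (lab l) v (i + x) = some (z x) := fun x => (hmod x).trans (hz x)
  have hy : ∀ x, par G (lab l) (z x) = some (z (x + 1)) := fun x => by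
    have := hz' (x + 1)
    rwa [← add_assoc, anc, hz' x, Option.bind_some] at this
  have hzp : ∀ x, z (x + p) = z x := fun x => by
    have h1 := hz (x + p)
    rw [Nat.add_mod_right, hz x] at h1
    exact (Option.some.inj h1).symm
  have hsane : ∀ x, ∃ t r, 2 * p < t ∧ Sane π l t (z x) r := fun x => by
    have hx := Nat.mod_lt x hp0
    obtain ⟨q, hq⟩ := hrun (i + x % p) (by omega) (z x) (hz x)
    exact ⟨_, q, by omega, sane_of_run π l _ _ _ hq⟩
  by_cases hst : ∃ x, (lab l (z x)).start = true
  · obtain ⟨x, hx⟩ := hst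
    obtain ⟨t, r, ht, S⟩ := hsane x
    have hf := S.fin p (by omega)
    have h1 := (ideal_fin_chain hy (p - 1) x).2
      ⟨by rw [show x + (p - 1 + 1) = x + p by omega, hzp, hx], 0, by omega, hx⟩
    rw [show p - 1 + 1 = p by omega, hf] at h1
    cases h1
  · push Not at hst
    have hst' : ∀ x, (lab l (z x)).start = false := fun x => by simpa using hst x
    refine election_fails (p := p) (B := 2 * p) hp0 le_rfl
      (e := fun t x => ((ideal G (lab l) t (z x)).lead, (ideal G (lab l) t (z x)).tok))
      (c := fun x => (lab l (z x)).next) (p0 := fun x => (lab l (z x)).parity)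
      (fun x => rfl) (fun t x => ideal_elect_chain hy t x) (fun t x => by simp only [hzp])
      fun t ht x => ?_
    obtain ⟨t', r, ht', S⟩ := hsane x
    have hc := (S.check t (by omega)).elect
    rw [hy, Option.map_some, Option.bind_some, Option.bind_some, ideal_item_chain hy] at hc
    refine hc ?_ ?_
    · by_contra hcon
      obtain ⟨i, -, hi⟩ := (ideal_seen_chain hy t x).1 (by simpa using hcon)
      rw [hst'] at hi
      cases hi
    · simp [isStart, hst']

end Soundness

/-! ### Labels of the prover as functions of the depth -/

section PathLabels

/-- Significance of the digit stored at depth `d`, for blocks of length `L`. -/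
def digit (L d : ℕ) : ℕ := if d / L % 2 = 1 then L - 1 - d % L else d % L

/-- The label of a vertex of depth `d`. -/
def pathLab (L d : ℕ) : Lab where
  color := d
  start := d % L = 0
  last := d % L = L - 1
  bit := (d / L).testBit (digit L d)
  carry := 2 ^ digit L d ∣ d / L + 1
  flip := d / L % 2 = 1
  parity := d.testBit 0
  next := !d.testBit (padicValNat 2 d + 1)

/-- Adding one to `i` carries into bit `s` exactly when the lower bits are all ones, which is the
divisibility by `2 ^ s`. -/
theorem testBit_succ_eq (i s : ℕ) :
    (i + 1).testBit s = xor (i.testBit s) (decide (2 ^ s ∣ i + 1)) := by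
  rw [Nat.testBit_eq_decide_div_mod_eq, Nat.testBit_eq_decide_div_mod_eq, Nat.succ_div]
  by_cases h : 2 ^ s ∣ i + 1
  · rcases Nat.mod_two_eq_zero_or_one (i / 2 ^ s) with h1 | h1 <;>
      simp [h, h1, Nat.add_mod]
  · simp [h]

theorem two_pow_succ_dvd {i s : ℕ} (hb : i.testBit s = true) (hc : 2 ^ s ∣ i + 1) :
    2 ^ (s + 1) ∣ i + 1 := by
  obtain ⟨q, hq⟩ := hc
  have h1 := Nat.succ_div (a := i) (b := 2 ^ s)
  rw [if_pos ⟨q, hq⟩, hq, Nat.mul_div_cancel_left _ (by positivity)] at h1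
  rw [Nat.testBit_eq_decide_div_mod_eq, decide_eq_true_eq] at hb
  rw [hq, pow_succ]
  exact mul_dvd_mul_left _ (by omega)

variable {L : ℕ}

theorem succ_div_mod (hL : 0 < L) (d : ℕ) :
    (d % L + 1 < L ∧ (d + 1) / L = d / L ∧ (d + 1) % L = d % L + 1) ∨
      (d % L = L - 1 ∧ (d + 1) / L = d / L + 1 ∧ (d + 1) % L = 0) := by
  have h1 := Nat.mod_lt d hL
  have h2 := Nat.div_add_mod d L
  by_cases h : d % L + 1 < L
  · left
    have e : d + 1 = (d % L + 1) + L * (d / L) := by omega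
    refine ⟨h, ?_, ?_⟩
    · rw [e, Nat.add_mul_div_left _ _ hL, Nat.div_eq_of_lt h, zero_add]
    · rw [e, Nat.add_mul_mod_self_left, Nat.mod_eq_of_lt h]
  · right
    have e : d + 1 = L * (d / L + 1) := by rw [mul_add]; omega
    refine ⟨by omega, ?_, ?_⟩
    · rw [e, Nat.mul_div_cancel_left _ hL]
    · rw [e, Nat.mul_mod_right]

/-- The highest digit has no carry. -/
theorem not_carry_of_high (hL : 0 < L) {d : ℕ} (hd : d + 1 < 2 ^ L) (h : digit L d = L - 1)
    (hb : (pathLab L d).bit = true) : (pathLab L d).carry = false := by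
  by_contra hc
  simp only [pathLab, h, Bool.not_eq_false, decide_eq_true_eq] at hb hc
  have h1 := Nat.le_of_dvd (Nat.succ_pos _) (two_pow_succ_dvd hb hc)
  rw [Nat.sub_add_cancel hL] at h1
  exact absurd (h1.trans (Nat.succ_le_succ (Nat.div_le_self d L))) (not_le.2 hd)

theorem carry_of_low {d : ℕ} (h : digit L d = 0) : (pathLab L d).carry = true := by
  simp [pathLab, h]

/-- Within a block significance grows with depth or falls with it, according to `flip`, hence the
two carry rules. The bound on `d` serves only the top digit. -/
theorem localOk_pathLab (hL : 0 < L) {d : ℕ} (hd : d + 1 < 2 ^ L) (q : Option Lab)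
    (hq : q = if 1 ≤ d then some (pathLab L (d - 1)) else none) :
    LocalOk (pathLab L d) q := by
  have hflip : ∀ d b, (pathLab L d).flip = b ↔ decide (d / L % 2 = 1) = b := fun d b => Iff.rfl
  have hprev : ∀ p, q = some p → ∃ d', d = d' + 1 ∧ p = pathLab L d' := by
    intro p hp
    cases d with
    | zero => simp [hq] at hp
    | succ d => exact ⟨d, rfl, by simpa [hq] using hp.symm⟩
  have hsame : ∀ d', (pathLab L (d' + 1)).start = false →
      (d' + 1) / L = d' / L ∧ (d' + 1) % L = d' % L + 1 ∧ d' % L + 1 < L := by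
    intro d' h
    rcases succ_div_mod hL d' with h1 | h1
    · exact ⟨h1.2.1, h1.2.2, h1.1⟩
    · simp [pathLab, h1.2.2] at h
  constructor
  · intro h
    cases d with
    | zero => simp [pathLab]
    | succ d => simp [hq] at h
  · intro p hp
    obtain ⟨d', rfl, rfl⟩ := hprev p hp
    rcases succ_div_mod hL d' with h1 | h1
    · simp only [pathLab, h1.2.2]
      rw [decide_eq_decide]
      omega
    · simp [pathLab, h1.2.2, h1.1]
  · intro p hp hs
    obtain ⟨d', rfl, rfl⟩ := hprev p hp
    simp only [pathLab, (hsame d' hs).1]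
  · intro p hp hs hf hb hc
    obtain ⟨d', rfl, rfl⟩ := hprev p hp
    obtain ⟨h1, h2, h3⟩ := hsame d' hs
    have hf1 : ¬ (d' / L % 2 = 1) := by simpa [hflip, h1] using hf
    have e : digit L (d' + 1) = digit L d' + 1 := by
      simp only [digit, h1, h2, if_neg hf1]
    simp only [pathLab, decide_eq_true_eq, e, h1] at hb hc ⊢
    exact two_pow_succ_dvd hb hc
  · intro p hp hs hf hb hc
    obtain ⟨d', rfl, rfl⟩ := hprev p hp
    obtain ⟨h1, h2, h3⟩ := hsame d' hs
    have hf1 : d' / L % 2 = 1 := by simpa [hflip, h1] using hf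
    have e : digit L d' = digit L (d' + 1) + 1 := by
      simp only [digit, h1, h2, if_pos hf1]
      omega
    simp only [pathLab, decide_eq_true_eq, h1] at hb hc ⊢
    rw [e]
    exact two_pow_succ_dvd hb hc
  · intro hs hf
    have hs' : d % L = 0 := by simpa [pathLab] using hs
    have hf' : ¬ (d / L % 2 = 1) := by simpa [hflip] using hf
    exact carry_of_low (by rw [digit, if_neg hf', hs'])
  · intro hs hf hb
    have hs' : d % L = 0 := by simpa [pathLab] using hs
    have hf' : d / L % 2 = 1 := by simpa [hflip] using hf
    exact not_carry_of_high hL hd (by rw [digit, if_pos hf', hs', Nat.sub_zero]) hb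
  · intro hs hf
    have hs' : d % L = L - 1 := by simpa [pathLab] using hs
    have hf' : d / L % 2 = 1 := by simpa [hflip] using hf
    exact carry_of_low (by rw [digit, if_pos hf', hs', Nat.sub_self])
  · intro hs hf hb
    have hs' : d % L = L - 1 := by simpa [pathLab] using hs
    have hf' : ¬ (d / L % 2 = 1) := by simpa [hflip] using hf
    exact not_carry_of_high hL hd (by rw [digit, if_neg hf', hs']) hb

/-- From offset `j`, going up `j` steps reaches the block start and `j + 1` more reach offset `L - 1
- j` of the previous block, where the opposite orientation stores the same significance. -/
theorem partnerOk_pathLab (hL : 0 < L) {d : ℕ} (hd : 2 * (d % L) + 1 ≤ d) :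
    PartnerOk (pathLab L d) (pathLab L (d - (2 * (d % L) + 1))) := by
  have h1 := Nat.mod_lt d hL
  have h2 := Nat.div_add_mod d L
  obtain ⟨i, hi⟩ : ∃ i, d / L = i + 1 := Nat.exists_eq_succ_of_ne_zero fun h => by
    rw [h, mul_zero] at h2; omega
  set j := d % L with hj
  have e : d - (2 * j + 1) = (L - 1 - j) + L * i := by
    rw [hi, mul_add] at h2; omega
  have hdiv : (d - (2 * j + 1)) / L = i := by
    rw [e, Nat.add_mul_div_left _ _ hL, Nat.div_eq_of_lt (by omega), zero_add]
  have hmod : (d - (2 * j + 1)) % L = L - 1 - j := by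
    rw [e, Nat.add_mul_mod_self_left, Nat.mod_eq_of_lt (by omega)]
  have hdig : digit L (d - (2 * j + 1)) = digit L d := by
    simp only [digit, hdiv, hmod, hi, ← hj]
    split_ifs <;> omega
  refine ⟨?_, ?_, ?_⟩
  · simp only [pathLab, hdiv, hi, ne_eq, decide_eq_decide]
    omega
  · simp only [pathLab, hmod, ← hj, decide_eq_decide]
    omega
  · simp only [pathLab, hdig, hdiv, hi]
    exact testBit_succ_eq _ _

theorem two_pow_succ_dvd_iff (k m : ℕ) :
    2 ^ (k + 1) ∣ m ↔ 2 ^ k ∣ m ∧ m.testBit k = false := by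
  rw [Nat.testBit_eq_decide_div_mod_eq]
  constructor
  · rintro ⟨q, rfl⟩
    refine ⟨⟨2 * q, by ring⟩, ?_⟩
    rw [pow_succ, mul_assoc, Nat.mul_div_cancel_left _ (by positivity)]
    simp
  · rintro ⟨⟨q, rfl⟩, h⟩
    rw [Nat.mul_div_cancel_left _ (by positivity)] at h
    rw [pow_succ]
    exact mul_dvd_mul_left _ (by simp at h; omega)

/-- A depth that is an odd multiple of `2 ^ k` drops out in phase `k` only. Adding `2 ^ k` to it
flips bit `k + 1`, which explains the negation in `next`. -/
theorem next_pathLab {k m : ℕ} (h : 2 ^ (k + 1) ∣ m) (hm : 0 < m) :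
    (pathLab L (m - 2 ^ k)).next = m.testBit (k + 1) := by
  obtain ⟨q, rfl⟩ := h
  obtain ⟨r, rfl⟩ : ∃ r, q = r + 1 := Nat.exists_eq_succ_of_ne_zero (by rintro rfl; simp at hm)
  have e : 2 ^ (k + 1) * (r + 1) - 2 ^ k = 2 ^ k * (2 * r + 1) := by
    rw [show 2 ^ (k + 1) * (r + 1) = 2 ^ k * (2 * r + 1) + 2 ^ k by ring]
    omega
  have hv : padicValNat 2 (2 ^ k * (2 * r + 1)) = k := by
    rw [padicValNat.mul (by positivity) (by omega), padicValNat.prime_pow,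
      padicValNat.eq_zero_of_not_dvd (by omega), add_zero]
  rw [e]
  simp only [pathLab, hv]
  rw [Nat.testBit_eq_decide_div_mod_eq, Nat.testBit_eq_decide_div_mod_eq,
    Nat.mul_div_cancel_left _ (by positivity), pow_succ, ← Nat.div_div_eq_div_mul,
    Nat.mul_div_cancel_left _ (by positivity), show (2 * r + 1) / 2 = r by omega]
  rw [Bool.eq_iff_iff]
  simp
  omega

/-- The election makes no error along a path with the labels of the prover. -/
theorem electOk_path {d : ℕ} {e : ℕ → ℕ → Option Bool × Option (Bool × Bool)}
    (h0 : ∀ x ≤ d, e 0 x =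
      (some (pathLab L (d - x)).parity, some ((pathLab L (d - x)).parity, (pathLab L (d - x)).next)))
    (hrec : ∀ t x, x + t < d →
      e (t + 1) x = electStep (pathLab L (d - x)).next (e t x).1 (e t (x + 1)).2)
    {t : ℕ} (ht : t < d) : ElectOk (e t 0).1 (e t 1).2 := by
  have gap : ∀ k x i, x + i ≤ d → 2 ^ k ∣ d - x → 0 < i → i < 2 ^ k → ¬ 2 ^ k ∣ d - (x + i) := by
    intro k x i hx h1 hi hik h2
    have h3 := (Nat.dvd_add_right h2).1 (show 2 ^ k ∣ d - (x + i) + i by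
      rwa [show d - (x + i) + i = d - x by omega])
    exact absurd (Nat.le_of_dvd hi h3) (by omega)
  have hper : ∀ k x, x + 2 ^ k ≤ d → (2 ^ k ∣ d - x ↔ 2 ^ k ∣ d - (x + 2 ^ k)) := by
    intro k x hx
    have hpos : 0 < 2 ^ k := by positivity
    rw [show d - x = d - (x + 2 ^ k) + 2 ^ k by omega]
    exact Nat.dvd_add_self_right
  have hphase : ∀ k x, x + (2 ^ k - 1) ≤ d → e (2 ^ k - 1) x =
      phaseStart (fun x => 2 ^ k ∣ d - x) (fun x => (d - x).testBit k)
        (fun x => (pathLab L (d - x)).next) x := by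
    intro k
    induction k with
    | zero => intro x hx; simpa [phaseStart, pathLab] using h0 x hx
    | succ k ih =>
      intro x hx
      have hpos : 0 < 2 ^ k := by positivity
      have hk2 : 2 ^ (k + 1) = 2 ^ k + 2 ^ k := by ring
      rw [show 2 ^ (k + 1) - 1 = (2 ^ k - 1) + 2 ^ k by omega] at hx ⊢
      rw [elect_phase_end hrec ih hpos (gap k) (hper k) x hx]
      have hiff := two_pow_succ_dvd_iff k (d - x)
      by_cases hS : 2 ^ (k + 1) ∣ d - x
      · have h1 := next_pathLab (L := L) hS (by omega)
        rw [show d - x - 2 ^ k = d - (x + 2 ^ k) by omega] at h1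
        simp only [phaseStart, hS, ← hiff, if_true, h1]
      · simp only [phaseStart, hS, ← hiff, if_false]
  -- `k` is the phase containing round `t`, that is, `2 ^ k - 1 ≤ t < 2 ^ (k + 1) - 1`.
  have hle := Nat.pow_log_le_self 2 (show t + 1 ≠ 0 by omega)
  have hlt := Nat.lt_pow_succ_log_self (b := 2) (by norm_num) (t + 1)
  rw [pow_succ] at hlt
  set k := Nat.log 2 (t + 1)
  have hpos : 0 < 2 ^ k := by positivity
  have := electOk_of_phase hrec (hphase k) (gap k) (i := t - (2 ^ k - 1)) (by omega) (x := 0)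
    (by omega) (fun h1 _ => by
      have h2 := Nat.testBit_two_pow_add_eq (d - (0 + 2 ^ k)) k
      rw [show 2 ^ k + (d - (0 + 2 ^ k)) = d - 0 by omega] at h2
      rw [h2]
      simp)
  rwa [show 2 ^ k - 1 + (t - (2 ^ k - 1)) = t by omega] at this

end PathLabels

/-! ### The defect-free run on a rooted tree -/

section Rooted

variable {V : Type} {G : SimpleGraph V} {lb : V → Lab} {δ : V → ℕ} {L : ℕ}

/-- The labels are those of the prover for the depth function `δ`. -/
structure DepthLabels (G : SimpleGraph V) (lb : V → Lab) (L : ℕ) (δ : V → ℕ) : Prop where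
  pos : 0 < L
  lab_eq : ∀ v, lb v = pathLab L (δ v)
  depth_par : ∀ v u, par G lb v = some u → δ v = δ u + 1
  depth_root : ∀ v, par G lb v = none → δ v = 0

namespace DepthLabels

theorem item (h : DepthLabels G lb L δ) (t : ℕ) (v : V) :
    (ideal G lb t v).item = if t ≤ δ v then some (pathLab L (δ v - t)) else none := by
  induction t generalizing v with
  | zero => simp [ideal, initRec, h.lab_eq]
  | succ t ih =>
    simp only [ideal, clean]
    cases hp : par G lb v with
    | none => simp [h.depth_root v hp]
    | some u =>
      rw [Option.map_some, Option.bind_some, ih u, h.depth_par v u hp]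
      simp

theorem isStart_item (h : DepthLabels G lb L δ) (t : ℕ) (v : V) :
    isStart (ideal G lb t v).item = true ↔ t ≤ δ v ∧ (δ v - t) % L = 0 := by
  rw [h.item]
  split_ifs with h1 <;> simp [isStart, pathLab, h1]

theorem mod_le_of_sub_mod {d s : ℕ} (hs : s ≤ d) (h : (d - s) % L = 0) : d % L ≤ s := by
  have : d % L = s % L := by
    conv_lhs => rw [← Nat.sub_add_cancel hs, Nat.add_mod, h, zero_add, Nat.mod_mod]
  rw [this]
  exact Nat.mod_le _ _

theorem sub_mod_self_mod (d : ℕ) : (d - d % L) % L = 0 := by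
  conv_lhs => rw [← Nat.div_add_mod d L]
  simp

theorem seen (h : DepthLabels G lb L δ) (t : ℕ) (v : V) :
    (ideal G lb t v).seen = true ↔ δ v % L ≤ t := by
  induction t with
  | zero => simp [ideal, initRec, h.lab_eq, pathLab]
  | succ t ih =>
    have e : (ideal G lb (t + 1) v).seen =
        ((ideal G lb t v).seen || isStart (ideal G lb (t + 1) v).item) := rfl
    rw [e, Bool.or_eq_true, ih, h.isStart_item]
    constructor
    · rintro (h1 | ⟨h1, h2⟩)
      · omega
      · exact mod_le_of_sub_mod h1 h2
    · intro h1
      rcases Nat.lt_or_eq_of_le h1 with h1 | h1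
      · exact Or.inl (by omega)
      · exact Or.inr ⟨h1 ▸ Nat.mod_le _ _, h1 ▸ sub_mod_self_mod _⟩

theorem fin (h : DepthLabels G lb L δ) (t : ℕ) (v : V) :
    (ideal G lb (t + 1) v).fin = true ↔
      δ v < t + 1 ∨ (δ v - (t + 1)) % L = 0 ∧ δ v % L ≤ t := by
  have e : (ideal G lb (t + 1) v).fin = ((ideal G lb (t + 1) v).item.isNone ||
      (isStart (ideal G lb (t + 1) v).item && (ideal G lb t v).seen)) := rfl
  rw [e, Bool.or_eq_true, Bool.and_eq_true, h.seen, h.isStart_item, h.item]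
  split_ifs with h1
  · simp [h1]; omega
  · simp; omega

theorem offset (h : DepthLabels G lb L δ) (j : ℕ) (v : V) (hj : δ v % L = j) :
    Offset G lb j v := by
  induction j generalizing v with
  | zero => simp [Offset, h.lab_eq, pathLab, hj]
  | succ j ih =>
    refine ⟨by simp [h.lab_eq, pathLab, hj], ?_⟩
    cases hp : par G lb v with
    | none => simp [h.depth_root v hp] at hj
    | some u =>
      refine ⟨u, rfl, ih u ?_⟩
      have := h.depth_par v u hp
      rw [this] at hj
      rcases succ_div_mod h.pos (δ u) with h1 | h1 <;> omega

theorem depth_anc (h : DepthLabels G lb L δ) (v : V) (x : ℕ) (hx : x ≤ δ v) :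
    ∃ u, anc G lb v x = some u ∧ δ u = δ v - x := by
  induction x with
  | zero => exact ⟨v, rfl, rfl⟩
  | succ x ih =>
    obtain ⟨u, hu, hd⟩ := ih (by omega)
    cases hp : par G lb u with
    | none => have := h.depth_root u hp; omega
    | some w =>
      refine ⟨w, by rw [anc, hu, Option.bind_some, hp], ?_⟩
      have := h.depth_par u w hp
      omega

theorem electOk (h : DepthLabels G lb L δ) {t : ℕ} {v : V} (ht : t < δ v) :
    ElectOk (ideal G lb t v).lead
      (((par G lb v).map (ideal G lb t)).bind Rec.tok) := by
  -- The value beyond the root is a dummy, outside the window `x ≤ δ v`.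
  let e : ℕ → ℕ → Option Bool × Option (Bool × Bool) := fun t x =>
    match anc G lb v x with
    | some u => ((ideal G lb t u).lead, (ideal G lb t u).tok)
    | none => (none, none)
  have he : ∀ t x u, anc G lb v x = some u →
      e t x = ((ideal G lb t u).lead, (ideal G lb t u).tok) := fun t x u hu => by
    simp only [e, hu]
  have hpar : ∀ x, x < δ v → ∃ u w, anc G lb v x = some u ∧ anc G lb v (x + 1) = some w ∧
      par G lb u = some w ∧ δ u = δ v - x := by
    intro x hx
    obtain ⟨u, hu, hd⟩ := h.depth_anc v x hx.le
    obtain ⟨w, hw, -⟩ := h.depth_anc v (x + 1) hx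
    refine ⟨u, w, hu, hw, ?_, hd⟩
    rwa [anc, hu, Option.bind_some] at hw
  have hok := electOk_path (L := L) (e := e) (d := δ v) (fun x hx => by
      obtain ⟨u, hu, hd⟩ := h.depth_anc v x hx
      rw [he 0 x u hu, ← hd, ← h.lab_eq]
      rfl) (fun t x hx => by
      obtain ⟨u, w, hu, hw, hp, hd⟩ := hpar x (by omega)
      rw [he _ x u hu, he _ x u hu, he _ (x + 1) w hw, ← hd, ← h.lab_eq]
      simp [ideal, clean, hp]) ht
  obtain ⟨u, w, hu, hw, hp, -⟩ := hpar 0 (by omega)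
  cases hu
  rw [he _ 0 v rfl, he _ 1 w hw] at hok
  rw [hp, Option.map_some, Option.bind_some]
  exact hok

theorem check (h : DepthLabels G lb L δ) {s : ℕ} {v : V} (hd : δ v + 1 < 2 ^ L)
    (hfin : (ideal G lb s v).fin = false) :
    Check (lb v) (ideal G lb s v) ((par G lb v).map (ideal G lb s)) := by
  have e : ((par G lb v).map (ideal G lb s)).bind Rec.item = (ideal G lb (s + 1) v).item := rfl
  have hslow := ideal_slow s _ v (h.offset _ v rfl)
  have hlt := Nat.mod_lt (δ v) h.pos
  constructor
  · intro hf
    cases s with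
    | succ s => cases hf
    | zero =>
      rw [e, h.lab_eq]
      exact localOk_pathLab h.pos hd _ (h.item 1 v)
  · intro hs q hq
    rw [e, h.item] at hq
    split_ifs at hq with h1
    cases hq
    have h2 : s = 2 * (δ v % L) := by
      rw [hslow] at hs
      unfold slowAt at hs
      split_ifs at hs with h2 h3
      exact h3
    rw [h.lab_eq, h2]
    exact partnerOk_pathLab h.pos (by omega)
  · intro h1 h2 h3
    rw [e, h.isStart_item] at h1
    rw [h.seen] at h2
    obtain ⟨h1, h4⟩ := h1
    have h5 : s < 2 * (δ v % L) := by
      rw [hslow] at h3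
      unfold slowAt at h3
      split_ifs at h3 with h6
      exact h6
    -- A start arriving after the first one lies in an earlier block, so `s + 1 ≥ δ v % L + L`; this
    -- exceeds `2 * (δ v % L)`, so the slow signal has already come.
    have h6 := Nat.div_add_mod (δ v) L
    obtain ⟨q, hq⟩ := Nat.dvd_of_mod_eq_zero h4
    have h7 : L * q < L * (δ v / L) := by omega
    have h8 := Nat.mul_le_mul_left L (Nat.succ_le_of_lt (Nat.lt_of_mul_lt_mul_left h7))
    rw [Nat.mul_succ] at h8
    omega
  · intro h1 _
    have h2 : ¬ (δ v % L ≤ s) := by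
      rw [← h.seen s v, h1]; simp
    exact h.electOk (by have := Nat.mod_le (δ v) L; omega)

/-- In the first block the ancestors run out; elsewhere the start of the previous block is at
distance `δ v % L + L`, less than `2 * L`. -/
theorem exists_fin (h : DepthLabels G lb L δ) (v : V) :
    ∃ s, s ≤ 2 * L ∧ (ideal G lb s v).fin = true := by
  have hlt := Nat.mod_lt (δ v) h.pos
  have h6 := Nat.div_add_mod (δ v) L
  by_cases hd : δ v < L
  · exact ⟨δ v + 1, by omega, (h.fin _ v).2 (Or.inl (by omega))⟩
  · refine ⟨δ v % L + (L - 1) + 1, by omega, (h.fin _ v).2 (Or.inr ⟨?_, by omega⟩)⟩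
    have h1 : 0 < δ v / L := Nat.div_pos (by omega) h.pos
    obtain ⟨i, hi⟩ : ∃ i, δ v / L = i + 1 := ⟨δ v / L - 1, by omega⟩
    rw [hi, mul_add] at h6
    have h7 := h.pos
    rw [show δ v - (δ v % L + (L - 1) + 1) = L * i by omega, Nat.mul_mod_right]

end DepthLabels

theorem accepts_of_depthLabels [DecidableEq V] (π : PortOrder G) (l : verifier.Labeling V)
    (h : DepthLabels G (lab l) L δ) (hgood : ∀ v, GoodAt G (lab l) v)
    (hd : ∀ v, δ v + 1 < 2 ^ L) {T : ℕ} (hT : 2 * L < T) (v : V) :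
    core π l T v = .halt true := by
  rcases core_eq_ideal π l hgood T (fun s _ v hf => h.check (hd v) (hf s le_rfl)) v with
    ⟨-, hf⟩ | ⟨hv, -⟩
  · obtain ⟨s, hs, hfs⟩ := h.exists_fin v
    rw [hf s (by omega)] at hfs
    cases hfs
  · exact hv

/-- In a tree every vertex other than the root has exactly one neighbour closer to the root. -/
theorem eq_of_dist_succ (hG : G.IsAcyclic) (hc : G.Connected) {r v u w : V} (hu : G.Adj v u)
    (hw : G.Adj v w) (hdu : G.dist r v = G.dist r u + 1) (hdw : G.dist r v = G.dist r w + 1) :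
    u = w := by
  obtain ⟨p, hp⟩ := hc.exists_walk_length_eq_dist r u
  obtain ⟨q, hq⟩ := hc.exists_walk_length_eq_dist r w
  have hp' := (p.concat hu.symm).isPath_of_length_eq_dist (by simp [hp, hdu])
  have hq' := (q.concat hw.symm).isPath_of_length_eq_dist (by simp [hq, hdw])
  have := congrArg (fun x : G.Path r v => x.1.penultimate)
    ((hG.subsingleton_path r v).elim ⟨_, hp'⟩ ⟨_, hq'⟩)
  simpa using this

theorem exists_adj_dist_succ (hc : G.Connected) {r v : V} (h : G.dist r v ≠ 0) :
    ∃ u, G.Adj v u ∧ G.dist r v = G.dist r u + 1 := by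
  obtain ⟨p, hp⟩ := hc.exists_walk_length_eq_dist r v
  have hnil : ¬ p.Nil := by
    rw [← SimpleGraph.Walk.length_eq_zero_iff, hp]
    exact h
  refine ⟨p.penultimate, (p.adj_penultimate hnil).symm, ?_⟩
  have h1 : G.dist r p.penultimate ≤ p.dropLast.length := SimpleGraph.dist_le _
  have h2 := (p.adj_penultimate hnil).diff_dist_adj (u := r)
  have h3 : p.dropLast.length + 1 = p.length := by
    simp
    omega
  omega

theorem zmod_three_cast_ne (a : ℕ) : ((a : ZMod 3) ≠ ((a + 1 : ℕ) : ZMod 3)) ∧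
    (((a + 1 : ℕ) : ZMod 3) + 1 ≠ (a : ZMod 3)) := by
  have : ∀ x : ZMod 3, x ≠ x + 1 ∧ x + 1 + 1 ≠ x := by decide
  rw [Nat.cast_add, Nat.cast_one]
  exact this _

theorem goodAt_of_tree (hG : G.IsAcyclic) (hc : G.Connected) (r : V)
    (hlab : ∀ v, lb v = pathLab L (G.dist r v)) (v : V) : GoodAt G lb v := by
  have hcol : ∀ v, (lb v).color = (G.dist r v : ZMod 3) := fun v => by rw [hlab]; rfl
  have hor := fun u (ha : G.Adj v u) =>
    hG.dist_eq_dist_add_one_of_adj_of_reachable r ha (hc r v)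
  have hup : ∀ u, G.Adj v u → (lb u).color + 1 = (lb v).color →
      G.dist r v = G.dist r u + 1 := by
    intro u ha h
    rcases hor u ha with h1 | h1
    · exact h1
    · rw [hcol, hcol, h1] at h
      exact absurd h (zmod_three_cast_ne _).2
  refine ⟨fun u ha => ?_, fun u w hu hw h1 h2 => ?_⟩
  · rw [hcol, hcol]
    rcases hor u ha with h1 | h1
    · rw [h1]; exact (zmod_three_cast_ne _).1
    · rw [h1]; exact (zmod_three_cast_ne _).1.symm
  · exact eq_of_dist_succ hG hc hu hw (hup u hu h1) (hup w hw h2)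

theorem depthLabels_of_tree (hG : G.IsAcyclic) (hc : G.Connected) (r : V) (hL : 0 < L)
    (hlab : ∀ v, lb v = pathLab L (G.dist r v)) : DepthLabels G lb L (G.dist r) := by
  have hcol : ∀ v, (lb v).color = (G.dist r v : ZMod 3) := fun v => by rw [hlab]; rfl
  refine ⟨hL, hlab, fun v u h => ?_, fun v h => ?_⟩
  · obtain ⟨ha, hcu⟩ := par_spec h
    rcases hG.dist_eq_dist_add_one_of_adj_of_reachable r ha (hc r v) with h1 | h1
    · exact h1
    · rw [hcol, hcol, h1] at hcu
      exact absurd hcu (zmod_three_cast_ne _).2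
  · by_contra h0
    obtain ⟨u, ha, hd⟩ := exists_adj_dist_succ hc h0
    have := par_of_adj (goodAt_of_tree hG hc r hlab v) ha
      (by rw [hcol, hcol, hd, Nat.cast_add, Nat.cast_one])
    rw [this] at h
    cases h

end Rooted

open scoped Classical in
/-- The scheme: the prover chooses a root and labels every vertex according to its depth. -/
noncomputable def scheme : ProofLabelingScheme where
  verifier := verifier
  prover V G v := [pathLab (Nat.log 2 G.diam + 2)
    (if h : Nonempty V then G.dist h.some v else 0)]

/-! ### The scheme and its complexity bounds -/

section Main

variable {V : Type} [DecidableEq V] {G : SimpleGraph V} (π : PortOrder G)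

theorem scheme_acceptsWithin [Finite V] (hc : G.Connected) (hG : G.IsAcyclic) {T : ℕ}
    (hT : 2 * Nat.log 2 G.diam + 4 < T) :
    scheme.verifier.AcceptsWithin π (scheme.prover V G) T := by
  intro v
  have hne := hc.nonempty
  have hlab : ∀ v, lab (scheme.prover V G) v =
      pathLab (Nat.log 2 G.diam + 2) (G.dist hne.some v) := fun v => by
    simp only [lab, scheme, hne, dif_pos]
    rfl
  -- The summand 2 in the block length pays for the rounding of the logarithm and for the increment.
  have hdist : ∀ v, G.dist hne.some v + 1 < 2 ^ (Nat.log 2 G.diam + 2) := fun v => by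
    have h1 : G.dist hne.some v ≤ G.diam :=
      SimpleGraph.dist_le_diam (SimpleGraph.connected_iff_ediam_ne_top.1 hc)
    have h2 := Nat.lt_pow_succ_log_self (b := 2) (by norm_num) G.diam
    rw [pow_succ]
    omega
  refine (result_eq π (scheme.prover V G) T v).trans ?_
  rw [accepts_of_depthLabels π (scheme.prover V G)
    (depthLabels_of_tree hG hc hne.some (by omega) hlab)
    (goodAt_of_tree hG hc hne.some hlab) hdist (by omega) v]
  rfl

theorem scheme_isPLS {C : ℕ} (hC : 6 ≤ C) :
    scheme.IsPLS (fun _ G => G.Connected) (fun _ G => G.IsAcyclic) (fun n => C * n) := by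
  have hhalt : ∀ (V : Type) [Fintype V] [DecidableEq V] (G : SimpleGraph V) (π : PortOrder G)
      (l : verifier.Labeling V) (v : V),
      ∃ b, core π l (C * Fintype.card V) v = .halt b := by
    intro V _ _ G π l v
    have h := halts_of_six_mul_card π l v
    cases hc : core π l (6 * Fintype.card V) v with
    | run r => rw [hc] at h; cases h
    | err => rw [hc] at h; cases h
    | halt b => exact ⟨b, core_halt_mono π l (Nat.mul_le_mul_right _ hC) hc⟩
  refine ⟨fun V _ _ G _ π l v => ?_, fun V _ _ G hc hG π => ⟨_,
    scheme_acceptsWithin π hc hG (Nat.lt_succ_self _)⟩, fun V _ _ G _ hG π l => ?_⟩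
  · obtain ⟨b, hb⟩ := hhalt V G π l v
    have := result_eq π l (C * Fintype.card V) v
    rw [hb] at this
    exact Option.isSome_iff_exists.2 ⟨b, this⟩
  · by_contra hrej
    refine not_all_accept π l hG (T := C * Fintype.card V) fun v => ?_
    obtain ⟨b, hb⟩ := hhalt V G π l v
    cases b with
    | true => exact hb
    | false =>
      refine absurd ⟨C * Fintype.card V, v, ?_⟩ hrej
      refine (result_eq π l _ v).trans ?_
      rw [hb]
      rfl

theorem one_le_size_sym : 1 ≤ Nat.size (Fintype.card verifier.Sym) := by
  rw [Nat.succ_le_iff, Nat.size_pos, Fintype.card_pos_iff]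
  exact ⟨labOf none⟩

theorem scheme_space_le (l : verifier.Labeling V) (r : ℕ) (v : V) :
    verifier.space (verifier.run π l r v) ≤
      (2 + Nat.size (Fintype.card verifier.State)) * (verifier.labelBits (l v) + 1) := by
  obtain ⟨s, hs⟩ := run_shape π l r v
  have h1 : Nat.size (l v).length ≤ (l v).length := Nat.size_le.2 Nat.lt_two_pow_self
  have h2 := Nat.mul_le_mul_left (l v).length one_le_size_sym
  rw [hs]
  simp only [Verifier.space, Verifier.labelBits]
  nlinarith [Nat.zero_le (Nat.size (Fintype.card verifier.State) *
    ((l v).length * Nat.size (Fintype.card verifier.Sym)))]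

end Main

end AcyclicityScheme

open AcyclicityScheme

theorem mainTheorem5 :
    ∃ (S : ProofLabelingScheme) (C : ℕ),
      -- an `O(n)`-round proof-labeling scheme for acyclicity of connected graphs
      S.IsPLS (fun _ G => G.Connected) (fun _ G => G.IsAcyclic) (fun n => C * n) ∧
      -- communication per edge and round
      S.verifier.messageBits ≤ C ∧
      -- on every labeling, the space of a vertex is linear in the size of its label
      (∀ (V : Type) [Fintype V] [DecidableEq V] (G : SimpleGraph V), G.Connected →
        ∀ (π : PortOrder G) (l : S.verifier.Labeling V) (r : ℕ) (v : V),
          S.verifier.space (S.verifier.run π l r v) ≤ C * (S.verifier.labelBits (l v) + 1)) ∧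
      -- label size, space and acceptance time for the labels of the prover
      (∀ (V : Type) [Fintype V] [DecidableEq V] (G : SimpleGraph V),
        G.Connected → G.IsAcyclic →
          (∀ v : V, S.verifier.labelBits (S.prover V G v) ≤
            C * (logStar (Fintype.card V) + 1)) ∧
          ∀ π : PortOrder G,
            (∀ (r : ℕ) (v : V), S.verifier.space (S.verifier.run π (S.prover V G) r v) ≤
              C * (logStar (Fintype.card V) + 1)) ∧
            S.verifier.AcceptsWithin π (S.prover V G) (C * (Nat.log 2 G.diam + 1))) := by
  set σ := Nat.size (Fintype.card verifier.Sym)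
  set κ := 2 + Nat.size (Fintype.card verifier.State)
  -- The label of the prover is a single letter, so all bounds in `logStar` follow from constant
  -- ones.
  have hbits : ∀ (V : Type) (G : SimpleGraph V) (v : V),
      verifier.labelBits (scheme.prover V G v) = σ := fun V G v => one_mul _
  have hκ : κ ≤ κ * (σ + 1) := Nat.le_mul_of_pos_right _ (Nat.succ_pos _)
  refine ⟨scheme, 6 + verifier.messageBits + σ + κ * (σ + 1), scheme_isPLS (by omega), ?_, ?_, ?_⟩
  · change verifier.messageBits ≤ _
    omega
  · intro V _ _ G _ π l r v
    exact (scheme_space_le π l r v).trans (Nat.mul_le_mul_right _ (by omega))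
  · intro V _ _ G hc hG
    refine ⟨fun v => ?_, fun π => ⟨fun r v => ?_, ?_⟩⟩
    · exact (hbits V G v).le.trans
        ((show σ ≤ _ by omega).trans (Nat.le_mul_of_pos_right _ (Nat.succ_pos _)))
    · refine (scheme_space_le π (scheme.prover V G) r v).trans ?_
      rw [hbits]
      exact (show κ * (σ + 1) ≤ _ by omega).trans
        (Nat.le_mul_of_pos_right _ (Nat.succ_pos _))
    · refine scheme_acceptsWithin π hc hG ?_
      have := Nat.mul_le_mul_right (Nat.log 2 G.diam + 1)
        (show 6 ≤ 6 + verifier.messageBits + σ + κ * (σ + 1) by omega)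
      omega
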